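/- Let $G=\mathrm{Res}_{\mathbf C/\mathbf R}\mathbf G_m=\mathrm{Spec}\,\mathbf R[X,Y]\left[\frac1{X^2+Y^2}\right]$. Identify $\mathbf R^2=\mathbf A^2(\mathbf R)$ with $\mathbf C$ and $G(\mathbf R)=\mathbf R^2\smallsetminus\{0\}$ with the group $\mathbf C^\times$ via $(x,y)\mapsto x+iy$, and let $E:\mathbf R^2=\mathbf C\to \mathbf C^\times=G(\mathbf R)$ be the map $z\mapsto e^{2\pi i z}$. By a subvariety we mean a closed subvariety. A subset $\mathcal V\subsetneq\mathbf R^2$ is called strongly bialgebraic if (a) there are algebraic subvarieties $V\subset\mathbf A^2_{\mathbf R}$ and $W'\subset G$ such that $\mathcal V=V(\mathbf R)$ and $E(\mathcal V)=W'(\mathbf R)$, and (b) $\mathcal V$ cannot be written as $V_1(\mathbf R)\cup V_2(\mathbf R)$ with $V_1,V_2\subset\mathbf A^2_{\mathbf R}$ algebraic subvarieties such that both inclusions $V_i(\mathbf R)\subset\mathcal V$ are proper. A point of $G(\mathbf R)=\mathbf C^\times$ is called special if it is a root of unity. Let $S^1(\mathbf R)=\{z\in\mathbf C^\times : |z|=1\}$.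 Let $W\subsetneq G$ be an irreducible subvariety with more than one real point. 1. The set $W(\mathbf R)$ is the image under $E$ of a strongly bialgebraic subset of $\mathbf R^2$ if and only if it is a $G(\mathbf R)$-translate $g\cdot S^1(\mathbf R)$, $g\in G(\mathbf R)=\mathbf C^\times$, of the unit circle. 2. If $W$ satisfies the equivalent conditions in (1), then $W(\mathbf R)$ contains a special point if and only if it contains infinitely many special points. 3. If $W(\mathbf R)$ contains infinitely many special points, then $W(\mathbf R)=S^1(\mathbf R)$. -/

import Mathlib

/-- The coordinate ring `ℝ[X, Y]` of the real affine plane `𝐀²`. -/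
abbrev PlaneRing : Type := MvPolynomial (Fin 2) ℝ

/-- The coordinate ring `ℝ[X, Y][1 / (X² + Y²)]` of `G = Res_{ℂ/ℝ} 𝐆ₘ`. -/
abbrev TorusRing : Type :=
  Localization.Away ((MvPolynomial.X 0 ^ 2 + MvPolynomial.X 1 ^ 2 : PlaneRing))

/-- The point of `Spec B` underlying an `ℝ`-point `B → ℝ`. -/
def realPoint {B : Type*} [CommRing B] [Algebra ℝ B] (φ : B →ₐ[ℝ] ℝ) : PrimeSpectrum B :=
  ⟨RingHom.ker φ, RingHom.ker_isPrime φ⟩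

/-- The set `V(ℝ)` of real points of a closed subset `V` of `𝐀² = Spec ℝ[X, Y]`, inside
`ℝ² = ℂ` (a point `(x, y)` is identified with `x + iy`). -/
def planePoints (V : Set (PrimeSpectrum PlaneRing)) : Set ℂ :=
  {z | ∃ φ : PlaneRing →ₐ[ℝ] ℝ, realPoint φ ∈ V ∧
    φ (MvPolynomial.X 0) = z.re ∧ φ (MvPolynomial.X 1) = z.im}

/-- The set `W(ℝ)` of real points of a closed subset `W` of `G = Spec ℝ[X, Y][1 / (X² + Y²)]`,
inside `G(ℝ) = ℂˣ` (a point `(x, y) ≠ (0, 0)` is identified with `x + iy`). -/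
def torusPoints (W : Set (PrimeSpectrum TorusRing)) : Set ℂˣ :=
  {z | ∃ φ : TorusRing →ₐ[ℝ] ℝ, realPoint φ ∈ W ∧
    φ (algebraMap PlaneRing TorusRing (MvPolynomial.X 0)) = (z : ℂ).re ∧
    φ (algebraMap PlaneRing TorusRing (MvPolynomial.X 1)) = (z : ℂ).im}

/-- The map `E : ℝ² = ℂ → G(ℝ) = ℂˣ`, `z ↦ exp (2πiz)`. -/
noncomputable def expMap (z : ℂ) : ℂˣ :=
  Units.mk0 (Complex.exp (2 * Real.pi * Complex.I * z)) (Complex.exp_ne_zero _)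

/-- Strongly bialgebraic subsets of `ℝ² = ℂ`: proper subsets that are algebraic, whose image under
`E` is algebraic in `G`, and that are not the union of two proper algebraic subsets. -/
structure IsStronglyBialgebraic (S : Set ℂ) : Prop where
  ne_univ : S ≠ Set.univ
  algebraic : ∃ V : Set (PrimeSpectrum PlaneRing), IsClosed V ∧ S = planePoints V
  algebraic_image : ∃ W : Set (PrimeSpectrum TorusRing), IsClosed W ∧ expMap '' S = torusPoints W
  irreducible : ¬ ∃ V₁ V₂ : Set (PrimeSpectrum PlaneRing), IsClosed V₁ ∧ IsClosed V₂ ∧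
    planePoints V₁ ⊂ S ∧ planePoints V₂ ⊂ S ∧ S = planePoints V₁ ∪ planePoints V₂

/-- The unit circle `S¹(ℝ)` in `G(ℝ) = ℂˣ`. -/
def unitCircle : Set ℂˣ := {z | ‖(z : ℂ)‖ = 1}

/-- Special points of `G(ℝ) = ℂˣ`: the torsion points, i.e. the roots of unity. -/
def IsSpecialPoint (z : ℂˣ) : Prop := IsOfFinOrder z

/-! The heart is an Ax–Lindemann statement, `eq_line_of_exp_relation`. Let `S` be strongly
bialgebraic with at least two points. Condition (b) makes its vanishing ideal prime, so `S` is an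
infinite irreducible real curve, and `E(S)` satisfies a nonzero polynomial equation. In the
variables `u = E(z)` and `ū` this equation is a sum of exponentials of the forms `2πi (m₀ z - m₁
z̄)` on `S`. Differentiating along a regular arc and eliminating terms leaves two exponents whose
difference `h` has `exp h` rational on the arc. Any two rational functions on a curve are
algebraically dependent, whereas `s` and `exp s` are not on a nontrivial connected set; so `h` is
constant. The real part of `h` is a multiple of `y` and its imaginary part a multiple of `x`, not
both zero, hence `S` is an axis-parallel line.

A vertical line maps to an open ray, which is not algebraic, and a horizontal line maps onto a
circle centred at `0`; this gives (1). Roots of unity have norm one, so a circle containing one of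
them is the unit circle, which contains infinitely many; this gives (2). For (3), an irreducible
curve sharing infinitely many points with the unit circle coincides with it. -/

/-! ### Primes of `k[X, Y]` and algebraic dependence on plane curves. -/

/-- The ring has Krull dimension two, so a chain `⊥ < P < Q < M` of primes is one step too long. -/
theorem isMaximal_of_bot_lt_of_lt {k : Type*} [Field k] {P Q : Ideal (MvPolynomial (Fin 2) k)}
    [P.IsPrime] [Q.IsPrime] (hP : P ≠ ⊥) (h : P < Q) : Q.IsMaximal := by
  obtain ⟨M, hM, hQM⟩ := Ideal.exists_le_maximal Q Ideal.IsPrime.ne_top'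
  rcases hQM.eq_or_lt with rfl | hlt
  · exact hM
  exfalso
  have h1 := Ideal.height_add_one_le_of_lt_of_isPrime (bot_lt_iff_ne_bot.2 hP)
  have h2 := Ideal.height_add_one_le_of_lt_of_isPrime h
  have h3 := Ideal.height_add_one_le_of_lt_of_isPrime hlt
  have h4 : (M.height : WithBot ℕ∞) ≤ 2 := by
    have := Ideal.height_le_ringKrullDim_of_isPrime (I := M)
    rw [MvPolynomial.ringKrullDim_of_isNoetherianRing, ringKrullDim_eq_zero_of_field] at this
    simpa using this
  have h5 : M.height ≤ 2 := (WithBot.coe_le_coe (b := 2)).1 h4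
  have h6 : (3 : ℕ∞) ≤ M.height := by
    calc (3 : ℕ∞) ≤ (⊥ : Ideal (MvPolynomial (Fin 2) k)).height + 1 + 1 + 1 := by
          have : (3 : ℕ∞) = 0 + 1 + 1 + 1 := by norm_num
          rw [this]; gcongr; exact zero_le
      _ ≤ P.height + 1 + 1 := by gcongr
      _ ≤ Q.height + 1 := by gcongr
      _ ≤ _ := h3
  exact absurd (h6.trans h5) (by decide)

/-- A minimal prime over `P + (f)` strictly contains `P`, hence is maximal; so each `M` is itself
one of these finitely many minimal primes. -/
theorem finite_setOf_isPrime_of_notMem {k : Type*} [Field k] {P : Ideal (MvPolynomial (Fin 2) k)}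
    [P.IsPrime] (hP : P ≠ ⊥) {f : MvPolynomial (Fin 2) k} (hf : f ∉ P) :
    {M : Ideal (MvPolynomial (Fin 2) k) | M.IsPrime ∧ P ≤ M ∧ f ∈ M}.Finite := by
  refine ((P ⊔ Ideal.span {f}).finite_minimalPrimes_of_isNoetherianRing).subset ?_
  rintro M ⟨hM, hPM, hfM⟩
  obtain ⟨Q, hQ, hQM⟩ := Ideal.exists_minimalPrimes_le (I := P ⊔ Ideal.span {f}) (J := M)
    (sup_le hPM ((Ideal.span_singleton_le_iff_mem _).2 hfM))
  have hQp : Q.IsPrime := hQ.1.1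
  have hPQ : P < Q := lt_of_le_of_ne (le_sup_left.trans hQ.1.2) fun h ↦
    hf (h ▸ (le_sup_right.trans hQ.1.2) (Ideal.mem_span_singleton_self f))
  have := isMaximal_of_bot_lt_of_lt hP hPQ
  rwa [← this.eq_of_le hM.ne_top hQM]

theorem finite_zeros_of_notMem {k : Type*} [Field k] {P : Ideal (MvPolynomial (Fin 2) k)}
    [P.IsPrime] (hP : P ≠ ⊥) {f : MvPolynomial (Fin 2) k} (hf : f ∉ P) :
    {v : Fin 2 → k | (∀ g ∈ P, MvPolynomial.aeval v g = 0) ∧ MvPolynomial.aeval v f = 0}.Finite := by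
  have hinj : Function.Injective fun v : Fin 2 → k ↦
      RingHom.ker (MvPolynomial.aeval v : MvPolynomial (Fin 2) k →ₐ[k] k) := by
    intro v w hvw
    funext i
    have : MvPolynomial.X i - MvPolynomial.C (v i) ∈
        RingHom.ker (MvPolynomial.aeval v : MvPolynomial (Fin 2) k →ₐ[k] k) := by
      simp [RingHom.mem_ker]
    have h2 : MvPolynomial.X i - MvPolynomial.C (v i) ∈
        RingHom.ker (MvPolynomial.aeval w : MvPolynomial (Fin 2) k →ₐ[k] k) := by
      have hvw' : RingHom.ker (MvPolynomial.aeval v : MvPolynomial (Fin 2) k →ₐ[k] k) =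
        RingHom.ker (MvPolynomial.aeval w : MvPolynomial (Fin 2) k →ₐ[k] k) := hvw
      rwa [← hvw']
    simp only [RingHom.mem_ker, map_sub, MvPolynomial.aeval_X, MvPolynomial.aeval_C,
      Algebra.algebraMap_self, RingHom.id_apply] at h2
    exact (sub_eq_zero.1 h2).symm
  refine ((finite_setOf_isPrime_of_notMem hP hf).preimage hinj.injOn).subset ?_
  rintro v ⟨h1, h2⟩
  exact ⟨RingHom.ker_isPrime _, fun g hg ↦ h1 g hg, h2⟩

theorem eq_span_singleton_of_irreducible_mem {k : Type*} [Field k]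
    {P : Ideal (MvPolynomial (Fin 2) k)} [P.IsPrime] (hP : ¬ P.IsMaximal)
    {p : MvPolynomial (Fin 2) k} (hp : Irreducible p) (hpP : p ∈ P) : P = Ideal.span {p} := by
  have : (Ideal.span {p}).IsPrime := (Ideal.span_singleton_prime hp.ne_zero).2 hp.prime
  by_contra hne
  refine hP (isMaximal_of_bot_lt_of_lt (P := Ideal.span {p}) ?_
    (lt_of_le_of_ne ((Ideal.span_singleton_le_iff_mem _).2 hpP) (Ne.symm hne)))
  simpa using hp.ne_zero

/-- Two elements of the localization of a proper quotient domain of `k[X, Y]` are algebraically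
dependent. -/
theorem exists_algebraic_relation {k : Type*} [Field k]
    {P : Ideal (MvPolynomial (Fin 2) k)} [P.IsPrime] (hP : P ≠ ⊥)
    {a b d : MvPolynomial (Fin 2) k} (hd : d ∉ P) :
    ∃ R : MvPolynomial (Fin 2) k, R ≠ 0 ∧ ∀ v : Fin 2 → k,
      (∀ g ∈ P, MvPolynomial.aeval v g = 0) → MvPolynomial.aeval v d ≠ 0 →
      MvPolynomial.aeval ![MvPolynomial.aeval v a, MvPolynomial.aeval v b / MvPolynomial.aeval v d] R
        = 0 := by
  set B := MvPolynomial (Fin 2) k ⧸ P with hB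
  set d' : B := Ideal.Quotient.mk P d with hd'
  have hd0 : d' ≠ 0 := by rwa [hd', Ne, Ideal.Quotient.eq_zero_iff_mem]
  let L := Localization.Away d'
  have hle : Submonoid.powers d' ≤ nonZeroDivisors B :=
    powers_le_nonZeroDivisors_of_noZeroDivisors hd0
  have : IsDomain L := IsLocalization.isDomain_localization hle
  let A := Algebra.adjoin k (Set.range fun i ↦ algebraMap B L (Ideal.Quotient.mk P (MvPolynomial.X i)))
  have hA : ∀ y : B, algebraMap B L y ∈ A := by
    intro y
    obtain ⟨y, rfl⟩ := Ideal.Quotient.mk_surjective y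
    induction y using MvPolynomial.induction_on with
    | C c =>
      exact A.algebraMap_mem c
    | add p q hp hq => simpa using add_mem hp hq
    | mul_X p i hp =>
      rw [map_mul, map_mul]
      exact mul_mem hp (Algebra.subset_adjoin ⟨i, rfl⟩)
  have halg : Algebra.IsAlgebraic A L := by
    refine ⟨fun z ↦ ?_⟩
    obtain ⟨⟨x, s⟩, hxs⟩ := IsLocalization.surj (Submonoid.powers d') z
    have hs : algebraMap B L s ≠ 0 := by
      intro h
      rw [← map_zero (algebraMap B L)] at h
      exact nonZeroDivisors.ne_zero (hle s.2) (IsLocalization.injective L hle h)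
    refine ⟨Polynomial.C ⟨_, hA s⟩ * Polynomial.X - Polynomial.C ⟨_, hA x⟩, ?_, ?_⟩
    · intro h
      have := congrArg (fun q ↦ Polynomial.coeff q 1) h
      simp [Polynomial.coeff_C] at this
      exact hs (congrArg Subtype.val this)
    · simp only [map_sub, map_mul, Polynomial.aeval_C, Polynomial.aeval_X]
      rw [sub_eq_zero, mul_comm]
      exact hxs
  have hdu : IsUnit (algebraMap B L d') := IsLocalization.Away.algebraMap_isUnit d'
  obtain ⟨u, hu⟩ := hdu
  let w : Fin 2 → L := ![algebraMap B L (Ideal.Quotient.mk P a),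
    algebraMap B L (Ideal.Quotient.mk P b) * (u⁻¹ : Lˣ)]
  -- Independence would force transcendence degree at least two. The classes of `X` and `Y`, over
  -- which `L` is algebraic, would then form a transcendence basis, contradicting a nonzero element
  -- of `P`.
  have hdep : ¬ AlgebraicIndependent k w := by
    intro hw
    have h2 := hw.lift_cardinalMk_le_trdeg
    have hT := Algebra.IsAlgebraic.isTranscendenceBasis_of_lift_le_trdeg_of_finite k
      (fun i ↦ algebraMap B L (Ideal.Quotient.mk P (MvPolynomial.X i))) (alg := halg) h2
    have hI := hT.1
    obtain ⟨p, hpP, hp0⟩ := Submodule.exists_mem_ne_zero_of_ne_bot hP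
    apply hp0
    have hev : ∀ q : MvPolynomial (Fin 2) k,
        MvPolynomial.aeval (fun i ↦ algebraMap B L (Ideal.Quotient.mk P (MvPolynomial.X i))) q =
        algebraMap B L (Ideal.Quotient.mk P q) := by
      intro q
      induction q using MvPolynomial.induction_on with
      | C c => simp only [MvPolynomial.aeval_C]; rfl
      | add p q hp hq => simp [hp, hq]
      | mul_X p i hp => simp [hp]
    apply hI
    rw [hev, Ideal.Quotient.eq_zero_iff_mem.2 hpP]
    simp
  obtain ⟨R, hR, hR0⟩ : ∃ R, MvPolynomial.aeval w R = 0 ∧ R ≠ 0 := by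
    by_contra! h
    exact hdep (algebraicIndependent_iff.2 h)
  refine ⟨R, hR0, fun v hv hdv ↦ ?_⟩
  -- A zero of `P` with `d ≠ 0` defines a `k`-point of `L`, which carries the relation over to
  -- values.
  let φ : B →ₐ[k] k := Ideal.Quotient.liftₐ P (MvPolynomial.aeval v) hv
  have hφ : ∀ q, φ (Ideal.Quotient.mk P q) = MvPolynomial.aeval v q := fun q ↦ rfl
  have hφu : ∀ y : Submonoid.powers d', IsUnit (φ y) := by
    rintro ⟨_, n, rfl⟩
    simpa [hd', hφ] using fun h ↦ absurd h hdv
  let ψ : L →ₐ[k] k := IsLocalization.liftAlgHom (M := Submonoid.powers d') hφu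
  have hψ : ∀ y, ψ (algebraMap B L y) = φ y := fun y ↦ by simp [ψ]
  have := congrArg ψ hR
  rw [map_zero, MvPolynomial.comp_aeval_apply] at this
  rw [← this]
  congr 2
  funext i
  fin_cases i
  · simp [w, hψ, hφ]
  · have hu' : ψ ((u⁻¹ : Lˣ) : L) = (MvPolynomial.aeval v d)⁻¹ := by
      rw [← hφ d, ← hd', ← hψ d', ← hu]
      refine eq_inv_of_mul_eq_one_left ?_
      rw [← map_mul]
      simp
    simp [w, hψ, hφ, hu', div_eq_mul_inv]

/-! ### Exponential-polynomial relations along a curve. -/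

theorem eq_zero_of_aeval_exp_eq_zero {R : MvPolynomial (Fin 2) ℂ} {U : Set ℂ}
    (hU : IsPreconnected U) (hU' : U.Nontrivial)
    (h : ∀ s ∈ U, MvPolynomial.aeval ![s, Complex.exp s] R = 0) : R = 0 := by
  have hdiff : ∀ R : MvPolynomial (Fin 2) ℂ,
      Differentiable ℂ fun s : ℂ ↦ MvPolynomial.aeval ![s, Complex.exp s] R := by
    intro R
    induction R using MvPolynomial.induction_on with
    | C c => simp
    | add p q hp hq => simpa using hp.fun_add hq
    | mul_X p i hp =>
      simp only [map_mul, MvPolynomial.aeval_X]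
      refine hp.mul ?_
      fin_cases i
      · exact differentiable_id
      · exact Complex.differentiable_exp
  obtain ⟨z, hz⟩ := hU'.nonempty
  have hacc : ∃ᶠ w in nhdsWithin z {z}ᶜ, w ∈ U :=
    Filter.frequently_mem_iff_neBot.mpr <| hU.preperfect_of_nontrivial hU' z hz
  have hall : (fun s : ℂ ↦ MvPolynomial.aeval ![s, Complex.exp s] R) = fun _ ↦ 0 :=
    AnalyticOnNhd.eq_of_frequently_eq (fun s _ ↦ (hdiff R).analyticAt s)
      (fun s _ ↦ analyticAt_const) (hacc.mono fun w hw ↦ h w hw)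
  -- For fixed `w ≠ 0`, the polynomial `R(·, w)` vanishes at the infinitely many logarithms of `w`.
  have key : ∀ s w : ℂ, w ≠ 0 → MvPolynomial.aeval ![s, w] R = 0 := by
    intro s w hw
    let q : Polynomial ℂ := MvPolynomial.aeval ![Polynomial.X, Polynomial.C w] R
    have hq : ∀ s, q.eval s = MvPolynomial.aeval ![s, w] R := by
      intro s
      have : q.eval s = Polynomial.aeval s q := by simp [Polynomial.aeval_def]
      rw [this, MvPolynomial.comp_aeval_apply]
      congr 2
      funext i
      fin_cases i <;> simp
    have hq0 : q = 0 := by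
      refine Polynomial.eq_zero_of_infinite_isRoot q ?_
      refine Set.Infinite.mono ?_ (Set.infinite_range_of_injective
        (f := fun n : ℕ ↦ Complex.log w + n * (2 * Real.pi * Complex.I)) ?_)
      · rintro _ ⟨n, rfl⟩
        have := congrFun hall (Complex.log w + n * (2 * Real.pi * Complex.I))
        rw [Complex.exp_periodic.nat_mul n, Complex.exp_log hw] at this
        rw [Set.mem_ofPred_eq, Polynomial.IsRoot, hq]
        exact this
      · intro m n hmn
        have h2 : (2 * Real.pi * Complex.I : ℂ) ≠ 0 := Complex.two_pi_I_ne_zero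
        simpa [h2] using hmn
    rw [← hq, hq0, Polynomial.eval_zero]
  have : R * MvPolynomial.X 1 = 0 := by
    refine MvPolynomial.funext fun v ↦ ?_
    by_cases hv : v 1 = 0
    · simp [hv]
    · have := key (v 0) (v 1) hv
      have hvv : ![v 0, v 1] = v := by funext i; fin_cases i <;> rfl
      rw [hvv] at this
      simp [← MvPolynomial.aeval_eq_eval, this]
  exact (mul_eq_zero.1 this).resolve_right (MvPolynomial.X_ne_zero _)

theorem hasDerivAt_aeval_mkDerivation {𝕜 : Type*} [RCLike 𝕜] {w : ℝ → Fin 2 → 𝕜}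
    {d : Fin 2 → MvPolynomial (Fin 2) 𝕜} {t : ℝ} (hw : ∀ i, HasDerivAt (fun t ↦ w t i) (MvPolynomial.aeval (w t) (d i)) t)
    (c : MvPolynomial (Fin 2) 𝕜) :
    HasDerivAt (fun t ↦ MvPolynomial.aeval (w t) c)
      (MvPolynomial.aeval (w t) (MvPolynomial.mkDerivation 𝕜 d c)) t := by
  induction c using MvPolynomial.induction_on with
  | C c => simpa using hasDerivAt_const t c
  | add p q hp hq => simpa using hp.fun_add hq
  | mul_X p i hp =>
    have := hp.mul (hw i)
    simp only [map_mul, MvPolynomial.aeval_X, Derivation.leibniz, MvPolynomial.mkDerivation_X,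
      smul_eq_mul, map_add]
    convert! this using 1
    ring

/-- Elimination in an exponential-polynomial relation along a curve: a relation between the
`exp hᵢ` produces two indices whose quotient of exponentials has the same logarithmic derivative as
a rational function. -/
theorem exists_logDeriv_relation {ι : Type*} [DecidableEq ι] {w : ℝ → Fin 2 → ℂ}
    {d : Fin 2 → MvPolynomial (Fin 2) ℂ} {J : Set ℝ} (hJ : IsOpen J)
    (hw : ∀ t ∈ J, ∀ i, HasDerivAt (fun t ↦ w t i) (MvPolynomial.aeval (w t) (d i)) t)
    {P : Ideal (MvPolynomial (Fin 2) ℂ)}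
    (hP : ∀ c, c ∈ P ↔ ∀ t ∈ J, MvPolynomial.aeval (w t) c = 0)
    (h : ι → MvPolynomial (Fin 2) ℂ) (n : ℕ) :
    ∀ (F : Finset ι) (c : ι → MvPolynomial (Fin 2) ℂ), F.card = n → F.Nonempty →
      (∀ i ∈ F, c i ∉ P) →
      (∀ t ∈ J, ∑ i ∈ F, MvPolynomial.aeval (w t) (c i) *
        Complex.exp (MvPolynomial.aeval (w t) (h i)) = 0) →
      ∃ i ∈ F, ∃ j ∈ F, i ≠ j ∧ ∃ a b, a ∉ P ∧ b ∉ P ∧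
        a * (MvPolynomial.mkDerivation ℂ d b + b * MvPolynomial.mkDerivation ℂ d (h j)) -
        (MvPolynomial.mkDerivation ℂ d a + a * MvPolynomial.mkDerivation ℂ d (h i)) * b ∈ P := by
  induction n using Nat.strong_induction_on with
  | _ n ih =>
  intro F c hn hF hc hrel
  set D := MvPolynomial.mkDerivation ℂ d
  obtain ⟨i₀, hi₀⟩ := hF
  -- Coefficients of `c i₀` times the differentiated relation minus `D (c i₀) + c i₀ * D (h i₀)`
  -- times the original one. The `i₀` term cancels, so the new relation is shorter.
  let e : ι → MvPolynomial (Fin 2) ℂ := fun i ↦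
    c i₀ * (D (c i) + c i * D (h i)) - (D (c i₀) + c i₀ * D (h i₀)) * c i
  by_cases hall : ∀ i ∈ F.erase i₀, e i ∈ P
  · by_cases hne : (F.erase i₀).Nonempty
    · obtain ⟨j, hj⟩ := hne
      exact ⟨i₀, hi₀, j, Finset.mem_of_mem_erase hj, (Finset.ne_of_mem_erase hj).symm,
        c i₀, c j, hc _ hi₀, hc _ (Finset.mem_of_mem_erase hj), hall j hj⟩
    · exfalso
      rw [Finset.not_nonempty_iff_eq_empty] at hne
      refine hc i₀ hi₀ ((hP _).2 fun t ht ↦ ?_)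
      have := hrel t ht
      rw [← Finset.insert_erase hi₀, hne] at this
      simpa using this
  · push Not at hall
    obtain ⟨j, hj, hjP⟩ := hall
    classical
    have hrel' : ∀ t ∈ J, ∑ i ∈ (F.erase i₀).filter fun i ↦ e i ∉ P, MvPolynomial.aeval (w t) (e i) *
        Complex.exp (MvPolynomial.aeval (w t) (h i)) = 0 := by
      intro t ht
      have hd : HasDerivAt (fun t ↦ ∑ i ∈ F, MvPolynomial.aeval (w t) (c i) *
          Complex.exp (MvPolynomial.aeval (w t) (h i)))
          (∑ i ∈ F, (MvPolynomial.aeval (w t) (D (c i)) *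
            Complex.exp (MvPolynomial.aeval (w t) (h i)) + MvPolynomial.aeval (w t) (c i) *
            (Complex.exp (MvPolynomial.aeval (w t) (h i)) *
              MvPolynomial.aeval (w t) (D (h i))))) t := by
        refine HasDerivAt.fun_sum fun i _ ↦ ?_
        exact (hasDerivAt_aeval_mkDerivation (hw t ht) (c i)).mul
          (hasDerivAt_aeval_mkDerivation (hw t ht) (h i)).cexp
      have hd0 := hd.unique ((hasDerivAt_const t (0 : ℂ)).congr_of_eventuallyEq
        (Filter.eventuallyEq_of_mem (hJ.mem_nhds ht) hrel))
      have hr := hrel t ht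
      have hsum : ∑ i ∈ F, MvPolynomial.aeval (w t) (e i) *
          Complex.exp (MvPolynomial.aeval (w t) (h i)) = 0 := by
        have : ∀ i ∈ F, MvPolynomial.aeval (w t) (e i) *
            Complex.exp (MvPolynomial.aeval (w t) (h i)) =
            MvPolynomial.aeval (w t) (c i₀) * (MvPolynomial.aeval (w t) (D (c i)) *
            Complex.exp (MvPolynomial.aeval (w t) (h i)) + MvPolynomial.aeval (w t) (c i) *
            (Complex.exp (MvPolynomial.aeval (w t) (h i)) *
              MvPolynomial.aeval (w t) (D (h i)))) -
            MvPolynomial.aeval (w t) (D (c i₀) + c i₀ * D (h i₀)) *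
              (MvPolynomial.aeval (w t) (c i) *
                Complex.exp (MvPolynomial.aeval (w t) (h i))) := by
          intro i _
          simp only [e, map_sub, map_mul, map_add]
          ring
        rw [Finset.sum_congr rfl this, Finset.sum_sub_distrib, ← Finset.mul_sum, ← Finset.mul_sum,
          hd0, hr]
        simp
      rw [Finset.sum_filter_of_ne, ← hsum, ← Finset.add_sum_erase F _ hi₀]
      · have : e i₀ = 0 := by simp only [e]; ring
        simp [this]
      · intro i _ hne heP
        exact hne (by rw [(hP _).1 heP t ht, zero_mul])
    obtain ⟨i, hi, j, hj, hij, hrest⟩ := ih ((F.erase i₀).filter fun i ↦ e i ∉ P).card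
      (hn ▸ (Finset.card_filter_le _ _).trans_lt (Finset.card_erase_lt_of_mem hi₀))
      ((F.erase i₀).filter fun i ↦ e i ∉ P) e rfl ⟨j, Finset.mem_filter.2 ⟨hj, hjP⟩⟩
      (fun i hi ↦ (Finset.mem_filter.1 hi).2) hrel'
    exact ⟨i, Finset.mem_of_mem_erase (Finset.mem_filter.1 hi).1, j,
      Finset.mem_of_mem_erase (Finset.mem_filter.1 hj).1, hij, hrest⟩

theorem exists_Ioo_subset_ne_zero {f : ℝ → ℂ} {a b t : ℝ} (ht : t ∈ Set.Ioo a b)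
    (hf : ContinuousOn f (Set.Ioo a b)) (h0 : f t ≠ 0) :
    ∃ a' b', a' < b' ∧ Set.Ioo a' b' ⊆ Set.Ioo a b ∧ ∀ s ∈ Set.Ioo a' b', f s ≠ 0 := by
  have h1 : ∀ᶠ s in nhds t, f s ≠ 0 :=
    (hf.continuousAt (isOpen_Ioo.mem_nhds ht)).eventually_ne h0
  obtain ⟨l, u, hlu, hsub⟩ := mem_nhds_iff_exists_Ioo_subset.1
    (Filter.inter_mem h1 (isOpen_Ioo.mem_nhds ht))
  exact ⟨l, u, hlu.1.trans hlu.2, fun s hs ↦ (hsub hs).2, fun s hs ↦ (hsub hs).1⟩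

/-- An exponential-polynomial relation along an algebraic curve forces the difference of two of its
exponents to be constant on an arc. -/
theorem exists_exponent_sub_constant {ι : Type*} [DecidableEq ι] {w : ℝ → Fin 2 → ℂ}
    {d : Fin 2 → MvPolynomial (Fin 2) ℂ} {α β : ℝ}
    (hw : ∀ t ∈ Set.Ioo α β, ∀ i,
      HasDerivAt (fun t ↦ w t i) (MvPolynomial.aeval (w t) (d i)) t)
    {P : Ideal (MvPolynomial (Fin 2) ℂ)} [P.IsPrime] (hP0 : P ≠ ⊥)
    (hP : ∀ c ∈ P, ∀ t ∈ Set.Ioo α β, MvPolynomial.aeval (w t) c = 0)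
    (hP' : ∀ a b, a < b → Set.Ioo a b ⊆ Set.Ioo α β → ∀ c,
      (∀ t ∈ Set.Ioo a b, MvPolynomial.aeval (w t) c = 0) → c ∈ P) (hαβ : α < β)
    (h : ι → MvPolynomial (Fin 2) ℂ) (F : Finset ι) (hF : F.Nonempty)
    (c : ι → MvPolynomial (Fin 2) ℂ) (hc : ∀ i ∈ F, c i ∉ P)
    (hrel : ∀ t ∈ Set.Ioo α β, ∑ i ∈ F, MvPolynomial.aeval (w t) (c i) *
        Complex.exp (MvPolynomial.aeval (w t) (h i)) = 0) :
    ∃ i ∈ F, ∃ j ∈ F, i ≠ j ∧ ∃ a b, a < b ∧ Set.Ioo a b ⊆ Set.Ioo α β ∧ ∃ κ : ℂ,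
      ∀ t ∈ Set.Ioo a b, MvPolynomial.aeval (w t) (h j - h i) = κ := by
  obtain ⟨i, hi, j, hj, hij, A, B, hA, hB, hAB⟩ := exists_logDeriv_relation isOpen_Ioo hw
    (fun c ↦ ⟨hP c, hP' α β hαβ subset_rfl c⟩) h F.card F c rfl hF hc hrel
  refine ⟨i, hi, j, hj, hij, ?_⟩
  have hcont : ∀ c : MvPolynomial (Fin 2) ℂ,
      ContinuousOn (fun t ↦ MvPolynomial.aeval (w t) c) (Set.Ioo α β) := fun c t ht ↦
    (hasDerivAt_aeval_mkDerivation (hw t ht) c).continuousAt.continuousWithinAt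
  obtain ⟨t, ht, htAB⟩ : ∃ t ∈ Set.Ioo α β, MvPolynomial.aeval (w t) (A * B) ≠ 0 := by
    by_contra! hcon
    exact (Ideal.IsPrime.mem_or_mem ‹_› (hP' α β hαβ subset_rfl _ hcon)).elim hA hB
  obtain ⟨a, b, hab, hsub, hne⟩ := exists_Ioo_subset_ne_zero ht (hcont _) htAB
  refine ⟨a, b, hab, hsub, ?_⟩
  have hneA : ∀ s ∈ Set.Ioo a b, MvPolynomial.aeval (w s) A ≠ 0 := fun s hs h0 ↦
    hne s hs (by rw [map_mul, h0]; ring)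
  have hneB : ∀ s ∈ Set.Ioo a b, MvPolynomial.aeval (w s) B ≠ 0 := fun s hs h0 ↦
    hne s hs (by rw [map_mul, h0]; ring)
  -- the quotient `B exp (h j - h i) / A` is constant on the arc
  have hder : ∀ s ∈ Set.Ioo a b, HasDerivAt (fun s ↦ MvPolynomial.aeval (w s) B *
      Complex.exp (MvPolynomial.aeval (w s) (h j - h i)) / MvPolynomial.aeval (w s) A) 0 s := by
    intro s hs
    have h1 := hasDerivAt_aeval_mkDerivation (hw s (hsub hs)) B
    have h2 := hasDerivAt_aeval_mkDerivation (hw s (hsub hs)) A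
    have h3 := hasDerivAt_aeval_mkDerivation (hw s (hsub hs)) (h j - h i)
    have h4 := (h1.mul h3.cexp).div h2 (hneA s hs)
    have h5 := hP _ hAB s (hsub hs)
    convert! h4 using 1
    rw [eq_comm, div_eq_zero_iff]
    left
    simp only [Pi.mul_apply, map_sub, map_mul, map_add] at h5 ⊢
    linear_combination Complex.exp (MvPolynomial.aeval (w s) (h j) -
      MvPolynomial.aeval (w s) (h i)) * h5
  obtain ⟨s₀, hs₀⟩ := Set.nonempty_Ioo.2 hab
  have hconst : ∀ s ∈ Set.Ioo a b, MvPolynomial.aeval (w s) B *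
      Complex.exp (MvPolynomial.aeval (w s) (h j - h i)) / MvPolynomial.aeval (w s) A =
      MvPolynomial.aeval (w s₀) B *
      Complex.exp (MvPolynomial.aeval (w s₀) (h j - h i)) / MvPolynomial.aeval (w s₀) A :=
    fun s hs ↦ isOpen_Ioo.is_const_of_deriv_eq_zero isPreconnected_Ioo
      (fun x hx ↦ (hder x hx).differentiableAt.differentiableWithinAt)
      (fun x hx ↦ (hder x hx).deriv) hs hs₀
  set k := MvPolynomial.aeval (w s₀) B *
      Complex.exp (MvPolynomial.aeval (w s₀) (h j - h i)) / MvPolynomial.aeval (w s₀) A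
  -- On the arc `exp (h j - h i) = k A / B`, a rational function, hence algebraically dependent on
  -- `h j - h i`.
  obtain ⟨R, hR0, hR⟩ := exists_algebraic_relation hP0 (a := h j - h i)
    (b := MvPolynomial.C k * A) hB
  by_contra! hnc
  refine hR0 (eq_zero_of_aeval_exp_eq_zero
    (U := (fun s ↦ MvPolynomial.aeval (w s) (h j - h i)) '' Set.Ioo a b)
    (isPreconnected_Ioo.image _ ((hcont _).mono hsub)) ?_ ?_)
  · obtain ⟨s, hs, hsne⟩ := hnc (MvPolynomial.aeval (w s₀) (h j - h i))
    exact ⟨_, ⟨s, hs, rfl⟩, _, ⟨s₀, hs₀, rfl⟩, hsne⟩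
  · rintro _ ⟨s, hs, rfl⟩
    rw [← hR (w s) (fun g hg ↦ hP g hg s (hsub hs)) (hneB s hs)]
    congr 4
    have h1 := hconst s hs
    rw [div_eq_iff (hneA s hs)] at h1
    rw [eq_div_iff (hneB s hs), mul_comm]
    refine h1.trans ?_
    simp

/-! ### Partial derivatives of an irreducible polynomial. -/

theorem totalDegree_pderiv_lt {k : Type*} [Field k] {p : MvPolynomial (Fin 2) k} {i : Fin 2}
    (h : MvPolynomial.pderiv i p ≠ 0) :
    (MvPolynomial.pderiv i p).totalDegree < p.totalDegree := by
  obtain ⟨m, hm, hdeg⟩ := Finset.exists_mem_eq_sup _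
    (Finset.nonempty_iff_ne_empty.2 (MvPolynomial.support_eq_empty.not.2 h))
    (fun s : Fin 2 →₀ ℕ ↦ s.sum fun _ e ↦ e)
  rw [MvPolynomial.totalDegree, hdeg]
  rw [MvPolynomial.mem_support_iff, MvPolynomial.coeff_pderiv] at hm
  have := MvPolynomial.le_totalDegree (MvPolynomial.mem_support_iff.2 (left_ne_zero_of_mul hm))
  refine lt_of_lt_of_le ?_ this
  rw [Finsupp.sum_add_index' (fun _ ↦ rfl) (fun _ _ _ ↦ rfl)]
  simp

/-- A nonzero partial derivative has smaller degree than `p`, so it is not a multiple of `p`; if all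
of them vanish, `p` is constant in characteristic zero. -/
theorem exists_pderiv_notMem_span {k : Type*} [Field k] [CharZero k] {p : MvPolynomial (Fin 2) k}
    (hp : Irreducible p) : ∃ i, MvPolynomial.pderiv i p ∉ Ideal.span {p} := by
  by_contra! h
  have h0 : ∀ i, MvPolynomial.pderiv i p = 0 := by
    intro i
    by_contra hi
    exact absurd (MvPolynomial.totalDegree_le_of_dvd_of_isDomain
      (Ideal.mem_span_singleton.1 (h i)) hi) (totalDegree_pderiv_lt hi).not_ge
  have hC : p = MvPolynomial.C (MvPolynomial.coeff 0 p) := by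
    ext m
    rw [MvPolynomial.coeff_C]
    split_ifs with hm
    · rw [hm]
    · obtain ⟨i, hi⟩ : ∃ i, m i ≠ 0 := by
        by_contra! h
        exact hm (Finsupp.ext h).symm
      have h1 := congrArg (MvPolynomial.coeff (m - Finsupp.single i 1)) (h0 i)
      have h2 : m - Finsupp.single i 1 + Finsupp.single i 1 = m :=
        tsub_add_cancel_of_le (by simpa [Finsupp.single_le_iff] using Nat.one_le_iff_ne_zero.2 hi)
      rw [MvPolynomial.coeff_pderiv, h2, MvPolynomial.coeff_zero] at h1
      exact (mul_eq_zero.1 h1).resolve_right (Nat.cast_add_one_ne_zero _)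
  have hne : MvPolynomial.coeff 0 p ≠ 0 := fun h ↦ hp.ne_zero (by rw [hC, h, map_zero])
  exact hp.not_isUnit (hC ▸ (isUnit_iff_ne_zero.2 hne).map MvPolynomial.C)

theorem mkDerivation_rotated_gradient_self {k : Type*} [Field k] (p : MvPolynomial (Fin 2) k) :
    MvPolynomial.mkDerivation k ![MvPolynomial.pderiv 1 p, -MvPolynomial.pderiv 0 p] p = 0 := by
  have : MvPolynomial.mkDerivation k ![MvPolynomial.pderiv 1 p, -MvPolynomial.pderiv 0 p] =
      MvPolynomial.pderiv 1 p • MvPolynomial.pderiv 0 -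
        MvPolynomial.pderiv 0 p • MvPolynomial.pderiv 1 := by
    refine MvPolynomial.derivation_ext fun i ↦ ?_
    fin_cases i <;> simp [MvPolynomial.mkDerivation_X, MvPolynomial.pderiv_X]
  rw [this]
  simp only [Derivation.coe_sub, Derivation.coe_smul, Pi.sub_apply, Pi.smul_apply, smul_eq_mul]
  ring

/-! ### Vanishing ideals of real point sets and regular arcs. -/

/-- The ideal of polynomials vanishing on a set of points. -/
noncomputable def pointIdeal (T : Set (Fin 2 → ℝ)) : Ideal (MvPolynomial (Fin 2) ℝ) :=
  ⨅ v ∈ T, RingHom.ker (MvPolynomial.aeval v : MvPolynomial (Fin 2) ℝ →ₐ[ℝ] ℝ)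

theorem mem_pointIdeal {T : Set (Fin 2 → ℝ)} {f : MvPolynomial (Fin 2) ℝ} :
    f ∈ pointIdeal T ↔ ∀ v ∈ T, MvPolynomial.aeval v f = 0 := by
  simp [pointIdeal, RingHom.mem_ker]

/-- The ideal of complex polynomials vanishing on a set of real points. -/
noncomputable def complexPointIdeal (T : Set (Fin 2 → ℝ)) : Ideal (MvPolynomial (Fin 2) ℂ) :=
  ⨅ v ∈ T, RingHom.ker
    (MvPolynomial.aeval (fun i ↦ (v i : ℂ)) : MvPolynomial (Fin 2) ℂ →ₐ[ℂ] ℂ)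

theorem mem_complexPointIdeal {T : Set (Fin 2 → ℝ)} {f : MvPolynomial (Fin 2) ℂ} :
    f ∈ complexPointIdeal T ↔ ∀ v ∈ T, MvPolynomial.aeval (fun i ↦ (v i : ℂ)) f = 0 := by
  simp [complexPointIdeal, RingHom.mem_ker]

theorem aeval_map_ofReal (v : Fin 2 → ℝ) (f : MvPolynomial (Fin 2) ℝ) :
    MvPolynomial.aeval (fun i ↦ (v i : ℂ)) (MvPolynomial.map Complex.ofRealHom f) =
      (MvPolynomial.aeval v f : ℝ) := by
  induction f using MvPolynomial.induction_on with
  | C c => simp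
  | add p q hp hq => simp only [map_add, hp, hq, Complex.ofReal_add]
  | mul_X p i hp => simp only [map_mul, hp, MvPolynomial.map_X, MvPolynomial.aeval_X,
      Complex.ofReal_mul]

theorem exists_re_im_polynomials (c : MvPolynomial (Fin 2) ℂ) :
    ∃ a b : MvPolynomial (Fin 2) ℝ, ∀ v : Fin 2 → ℝ,
      MvPolynomial.aeval (fun i ↦ (v i : ℂ)) c =
        (MvPolynomial.aeval v a : ℝ) + (MvPolynomial.aeval v b : ℝ) * Complex.I := by
  induction c using MvPolynomial.induction_on with
  | C c => exact ⟨MvPolynomial.C c.re, MvPolynomial.C c.im, fun v ↦ by simp⟩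
  | add p q hp hq =>
    obtain ⟨a, b, h⟩ := hp
    obtain ⟨a', b', h'⟩ := hq
    refine ⟨a + a', b + b', fun v ↦ ?_⟩
    simp only [map_add, h, h', Complex.ofReal_add]
    ring
  | mul_X p i hp =>
    obtain ⟨a, b, h⟩ := hp
    refine ⟨a * MvPolynomial.X i, b * MvPolynomial.X i, fun v ↦ ?_⟩
    simp only [map_mul, h, MvPolynomial.aeval_X, Complex.ofReal_mul]
    ring

theorem ofReal_add_mul_I_eq_zero {x y : ℝ} : (x : ℂ) + y * Complex.I = 0 ↔ x = 0 ∧ y = 0 := by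
  simp [Complex.ext_iff]

theorem complexPointIdeal_isPrime {T : Set (Fin 2 → ℝ)} [hT : (pointIdeal T).IsPrime] :
    (complexPointIdeal T).IsPrime := by
  have key : ∀ c : MvPolynomial (Fin 2) ℂ, ∃ a : MvPolynomial (Fin 2) ℝ, ∀ v : Fin 2 → ℝ, (MvPolynomial.aeval v a : ℝ) = 0 ↔
      MvPolynomial.aeval (fun i ↦ (v i : ℂ)) c = 0 := by
    intro c
    obtain ⟨a, b, h⟩ := exists_re_im_polynomials c
    refine ⟨a ^ 2 + b ^ 2, fun v ↦ ?_⟩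
    rw [h, ofReal_add_mul_I_eq_zero, map_add, map_pow, map_pow,
      add_eq_zero_iff_of_nonneg (sq_nonneg _) (sq_nonneg _)]
    simp
  refine ⟨?_, ?_⟩
  · intro h
    refine hT.ne_top ((Ideal.eq_top_iff_one _).2 (mem_pointIdeal.2 fun v hv ↦ ?_))
    have := mem_complexPointIdeal.1 ((Ideal.eq_top_iff_one _).1 h) v hv
    simp at this
  · intro c c' hcc
    obtain ⟨a, ha⟩ := key c
    obtain ⟨a', ha'⟩ := key c'
    have : a * a' ∈ pointIdeal T := by
      refine mem_pointIdeal.2 fun v hv ↦ ?_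
      have := mem_complexPointIdeal.1 hcc v hv
      rw [map_mul, mul_eq_zero, ← ha, ← ha'] at this
      rwa [map_mul, mul_eq_zero]
    refine (hT.mem_or_mem this).imp (fun h ↦ ?_) fun h ↦ ?_
    · exact mem_complexPointIdeal.2 fun v hv ↦ (ha v).1 (mem_pointIdeal.1 h v hv)
    · exact mem_complexPointIdeal.2 fun v hv ↦ (ha' v).1 (mem_pointIdeal.1 h v hv)

theorem mem_pointIdeal_of_infinite {T : Set (Fin 2 → ℝ)} [hT : (pointIdeal T).IsPrime]
    (hT0 : pointIdeal T ≠ ⊥) {f : MvPolynomial (Fin 2) ℝ} {U : Set (Fin 2 → ℝ)}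
    (hUT : U ⊆ T) (hU : U.Infinite) (hf : ∀ v ∈ U, MvPolynomial.aeval v f = 0) :
    f ∈ pointIdeal T := by
  by_contra h
  refine hU ((finite_zeros_of_notMem hT0 h).subset fun v hv ↦ ⟨fun g hg ↦ ?_, hf v hv⟩)
  exact mem_pointIdeal.1 hg v (hUT hv)

theorem mem_complexPointIdeal_of_infinite {T : Set (Fin 2 → ℝ)} [hT : (pointIdeal T).IsPrime]
    (hT0 : pointIdeal T ≠ ⊥) {f : MvPolynomial (Fin 2) ℂ} {U : Set (Fin 2 → ℝ)}
    (hUT : U ⊆ T) (hU : U.Infinite)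
    (hf : ∀ v ∈ U, MvPolynomial.aeval (fun i ↦ (v i : ℂ)) f = 0) :
    f ∈ complexPointIdeal T := by
  obtain ⟨a, b, h⟩ := exists_re_im_polynomials f
  have ha := mem_pointIdeal_of_infinite hT0 hUT hU (f := a) fun v hv ↦
    (ofReal_add_mul_I_eq_zero.1 ((h v).symm.trans (hf v hv))).1
  have hb := mem_pointIdeal_of_infinite hT0 hUT hU (f := b) fun v hv ↦
    (ofReal_add_mul_I_eq_zero.1 ((h v).symm.trans (hf v hv))).2
  exact mem_complexPointIdeal.2 fun v hv ↦ by
    rw [h, mem_pointIdeal.1 ha v hv, mem_pointIdeal.1 hb v hv]; simp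

theorem pointIdeal_not_isMaximal {T : Set (Fin 2 → ℝ)} (hT : T.Nontrivial) :
    ¬ (pointIdeal T).IsMaximal := by
  intro hmax
  obtain ⟨v, hv, w, hw, hvw⟩ := hT
  have hle : pointIdeal T ≤
      RingHom.ker (MvPolynomial.aeval v : MvPolynomial (Fin 2) ℝ →ₐ[ℝ] ℝ) :=
    fun f hf ↦ mem_pointIdeal.1 hf v hv
  have heq := hmax.eq_of_le (RingHom.ker_ne_top _) hle
  refine hvw (funext fun i ↦ ?_)
  have : (MvPolynomial.X i - MvPolynomial.C (v i) : MvPolynomial (Fin 2) ℝ) ∈ pointIdeal T := by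
    rw [heq, RingHom.mem_ker]
    simp
  have := mem_pointIdeal.1 this w hw
  rw [map_sub, MvPolynomial.aeval_X, MvPolynomial.aeval_C] at this
  exact (sub_eq_zero.1 this).symm

/-- An infinite irreducible real algebraic curve contains a regular arc, an integral curve of a
polynomial vector field. -/
theorem exists_regular_arc {T : Set (Fin 2 → ℝ)} [hT : (pointIdeal T).IsPrime]
    (hT0 : pointIdeal T ≠ ⊥) (hTi : T.Infinite)
    (hTz : ∀ v, (∀ f ∈ pointIdeal T, MvPolynomial.aeval v f = 0) → v ∈ T) :
    ∃ (γ : ℝ → Fin 2 → ℝ) (d : Fin 2 → MvPolynomial (Fin 2) ℝ) (α β : ℝ), α < β ∧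
      ∀ t ∈ Set.Ioo α β, γ t ∈ T ∧
        (∀ i, HasDerivAt (fun t ↦ γ t i) (MvPolynomial.aeval (γ t) (d i)) t) ∧
        ∃ i, MvPolynomial.aeval (γ t) (d i) ≠ 0 := by
  obtain ⟨p, hpT, hp⟩ := hT.exists_mem_prime_of_ne_bot hT0
  have hspan := eq_span_singleton_of_irreducible_mem (pointIdeal_not_isMaximal hTi.nontrivial)
    hp.irreducible hpT
  obtain ⟨j, hj⟩ := exists_pderiv_notMem_span hp.irreducible
  rw [← hspan, mem_pointIdeal] at hj
  push Not at hj
  obtain ⟨v, hv, hjv⟩ := hj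
  -- The rotated gradient of `p`: its integral curves stay on level sets of `p`, and it is nonzero
  -- at the smooth point `v`.
  let d : Fin 2 → MvPolynomial (Fin 2) ℝ := ![MvPolynomial.pderiv 1 p, -MvPolynomial.pderiv 0 p]
  obtain ⟨j', hj'⟩ : ∃ j', MvPolynomial.aeval v (d j') ≠ 0 := by
    fin_cases j
    · exact ⟨1, by simpa [d] using hjv⟩
    · exact ⟨0, by simpa [d] using hjv⟩
  have hsmooth : ∀ f : MvPolynomial (Fin 2) ℝ,
      ContDiff ℝ 1 fun x : Fin 2 → ℝ ↦ MvPolynomial.aeval x f := by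
    intro f
    induction f using MvPolynomial.induction_on with
    | C c => simpa using contDiff_const
    | add p q hp hq => simpa only [map_add] using hp.add hq
    | mul_X p i hp =>
      simp only [map_mul, MvPolynomial.aeval_X]
      exact hp.mul (contDiff_apply _ _ i)
  have hX : ContDiff ℝ 1 fun x : Fin 2 → ℝ ↦ fun i ↦ MvPolynomial.aeval x (d i) :=
    contDiff_pi.2 fun i ↦ hsmooth (d i)
  obtain ⟨γ, hγ0, ε, hε, hγ⟩ :=
    (hX.contDiffAt (x := v)).exists_forall_mem_closedBall_exists_eq_forall_mem_Ioo_hasDerivAt₀ 0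
  simp only [zero_sub, zero_add] at hγ
  have h0mem : (0 : ℝ) ∈ Set.Ioo (-ε) ε := ⟨by linarith, hε⟩
  have hγi : ∀ t ∈ Set.Ioo (-ε) ε, ∀ i,
      HasDerivAt (fun t ↦ γ t i) (MvPolynomial.aeval (γ t) (d i)) t := fun t ht i ↦
    (hasDerivAt_pi.1 (hγ t ht)) i
  have hder : ∀ t ∈ Set.Ioo (-ε) ε, HasDerivAt (fun t ↦ MvPolynomial.aeval (γ t) p) 0 t := by
    intro t ht
    have := hasDerivAt_aeval_mkDerivation (hγi t ht) p
    rwa [mkDerivation_rotated_gradient_self, map_zero] at this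
  have hpγ : ∀ t ∈ Set.Ioo (-ε) ε, MvPolynomial.aeval (γ t) p = 0 := by
    intro t ht
    have := isOpen_Ioo.is_const_of_deriv_eq_zero isPreconnected_Ioo
      (fun x hx ↦ (hder x hx).differentiableAt.differentiableWithinAt)
      (fun x hx ↦ (hder x hx).deriv) ht h0mem
    rw [this, hγ0]
    exact mem_pointIdeal.1 hpT v hv
  have hcont : ContinuousAt (fun t ↦ MvPolynomial.aeval (γ t) (d j')) 0 :=
    (hasDerivAt_aeval_mkDerivation (hγi 0 h0mem) (d j')).continuousAt
  have hne : ∀ᶠ t in nhds 0, MvPolynomial.aeval (γ t) (d j') ≠ 0 :=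
    hcont.eventually_ne (by rwa [hγ0])
  obtain ⟨l, u, hlu, hsub⟩ := mem_nhds_iff_exists_Ioo_subset.1
    (Filter.inter_mem hne (isOpen_Ioo.mem_nhds h0mem))
  refine ⟨γ, d, l, u, hlu.1.trans hlu.2, fun t ht ↦ ⟨hTz _ fun f hf ↦ ?_, hγi t (hsub ht).2,
    j', (hsub ht).1⟩⟩
  rw [hspan, Ideal.mem_span_singleton] at hf
  obtain ⟨g, rfl⟩ := hf
  rw [map_mul, hpγ t (hsub ht).2, zero_mul]

theorem infinite_image_regular_arc {γ : ℝ → Fin 2 → ℝ} {d : Fin 2 → MvPolynomial (Fin 2) ℝ}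
    {a b : ℝ} (hab : a < b) (hγ : ∀ t ∈ Set.Ioo a b,
        (∀ i, HasDerivAt (fun t ↦ γ t i) (MvPolynomial.aeval (γ t) (d i)) t) ∧
        ∃ i, MvPolynomial.aeval (γ t) (d i) ≠ 0) : (γ '' Set.Ioo a b).Infinite := by
  refine (isPreconnected_Ioo.image γ fun t ht ↦ ?_).infinite_of_nontrivial ?_
  · exact (continuousAt_pi.2 fun i ↦ ((hγ t ht).1 i).continuousAt).continuousWithinAt
  · by_contra h
    rw [Set.not_nontrivial_iff] at h
    obtain ⟨t, ht⟩ := Set.nonempty_Ioo.2 hab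
    obtain ⟨hd, i, hi⟩ := hγ t ht
    refine hi ((hd i).unique ((hasDerivAt_const t (γ t i)).congr_of_eventuallyEq ?_))
    filter_upwards [isOpen_Ioo.mem_nhds ht] with s hs
    exact congrFun (h ⟨s, hs, rfl⟩ ⟨t, ht, rfl⟩) i

/-! ### The Ax–Lindemann theorem for `E`. -/

/-- The real coordinates of a complex number. -/
def realCoords (z : ℂ) : Fin 2 → ℝ := ![z.re, z.im]

/-- Substitute `x = (u + ū) / 2` and `y = (u - ū) / 2i`; this linear change of variables is
invertible, so `Q` is nonzero. -/
theorem exists_conj_polynomial {q : MvPolynomial (Fin 2) ℝ} (hq : q ≠ 0) :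
    ∃ Q : MvPolynomial (Fin 2) ℂ, Q ≠ 0 ∧ ∀ u : ℂ,
      MvPolynomial.aeval ![u, (starRingEnd ℂ) u] Q = (MvPolynomial.aeval (realCoords u) q : ℝ) := by
  let φ : MvPolynomial (Fin 2) ℂ →ₐ[ℂ] MvPolynomial (Fin 2) ℂ := MvPolynomial.aeval
    ![MvPolynomial.C (1 / 2) * (MvPolynomial.X 0 + MvPolynomial.X 1),
      MvPolynomial.C (1 / (2 * Complex.I)) * (MvPolynomial.X 0 - MvPolynomial.X 1)]
  have hφ : ∀ (v : Fin 2 → ℂ) f, MvPolynomial.aeval v (φ f) =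
      MvPolynomial.aeval ![1 / 2 * (v 0 + v 1), 1 / (2 * Complex.I) * (v 0 - v 1)] f := by
    intro v f
    rw [MvPolynomial.comp_aeval_apply]
    congr 2
    funext i
    fin_cases i <;> simp
  refine ⟨φ (MvPolynomial.map Complex.ofRealHom q), fun h0 ↦ hq ?_, fun u ↦ ?_⟩
  · have hinj := MvPolynomial.map_injective (σ := Fin 2) Complex.ofRealHom Complex.ofReal_injective
    apply hinj
    rw [map_zero]
    refine MvPolynomial.funext fun v ↦ ?_
    have h1 := hφ ![v 0 + v 1 * Complex.I, v 0 - v 1 * Complex.I]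
      (MvPolynomial.map Complex.ofRealHom q)
    have h2 : ![1 / 2 * ((v 0 + v 1 * Complex.I) + (v 0 - v 1 * Complex.I)),
        1 / (2 * Complex.I) * ((v 0 + v 1 * Complex.I) - (v 0 - v 1 * Complex.I))] = v := by
      funext i
      fin_cases i
      · simp; ring
      · simp; field_simp; ring_nf; rw [Complex.I_sq]; ring
    rw [h0, map_zero] at h1
    simp only [Matrix.cons_val_zero, Matrix.cons_val_one] at h1
    rw [h2] at h1
    simpa using h1.symm
  · rw [hφ, ← aeval_map_ofReal]
    congr 2
    funext i
    fin_cases i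
    · simp [realCoords, Complex.add_conj]
    · simp only [realCoords, Matrix.cons_val_zero, Matrix.cons_val_one, Complex.sub_conj,
        Fin.mk_one]
      field_simp
      push_cast
      ring

theorem conj_exp_two_pi_I_mul (x y : ℝ) :
    (starRingEnd ℂ) (Complex.exp (2 * Real.pi * Complex.I * (x + y * Complex.I))) =
      Complex.exp (-(2 * Real.pi * Complex.I * (x - y * Complex.I))) := by
  rw [← Complex.exp_conj]
  congr 1
  simp only [map_mul, map_add, map_ofNat, Complex.conj_ofReal, Complex.conj_I]
  ring

/-- The linear form `2πi (m₀ (X + iY) - m₁ (X - iY))`. -/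
noncomputable def frequencyForm (m : Fin 2 →₀ ℕ) : MvPolynomial (Fin 2) ℂ :=
  MvPolynomial.C (2 * Real.pi * Complex.I * ((m 0 : ℂ) - m 1)) * MvPolynomial.X 0 -
    MvPolynomial.C (2 * Real.pi * ((m 0 : ℂ) + m 1)) * MvPolynomial.X 1

theorem aeval_exp_eq_sum (Q : MvPolynomial (Fin 2) ℂ) (v : Fin 2 → ℝ) :
    MvPolynomial.aeval ![Complex.exp (2 * Real.pi * Complex.I * (v 0 + v 1 * Complex.I)),
      (starRingEnd ℂ) (Complex.exp (2 * Real.pi * Complex.I * (v 0 + v 1 * Complex.I)))] Q =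
    ∑ m ∈ Q.support, MvPolynomial.aeval (fun i ↦ (v i : ℂ)) (MvPolynomial.C (Q.coeff m)) *
      Complex.exp (MvPolynomial.aeval (fun i ↦ (v i : ℂ)) (frequencyForm m)) := by
  rw [conj_exp_two_pi_I_mul, MvPolynomial.aeval_eq_eval, MvPolynomial.eval_eq']
  refine Finset.sum_congr rfl fun m _ ↦ ?_
  rw [Fin.prod_univ_two, MvPolynomial.aeval_C]
  simp only [Matrix.cons_val_zero, Matrix.cons_val_one, ← Complex.exp_nat_mul, ← Complex.exp_add,
    frequencyForm, map_sub, map_mul, MvPolynomial.aeval_C, MvPolynomial.aeval_X,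
    Algebra.algebraMap_self, RingHom.id_apply]
  congr 2
  linear_combination (2 * Real.pi * v 1 * ((m 0 : ℂ) + m 1)) * Complex.I_sq

theorem aeval_frequencyForm_sub (m n : Fin 2 →₀ ℕ) (v : Fin 2 → ℝ) :
    MvPolynomial.aeval (fun i ↦ (v i : ℂ)) (frequencyForm n - frequencyForm m) =
      ((-(2 * Real.pi * (((n 0 : ℝ) + n 1) - (m 0 + m 1)) * v 1) : ℝ) : ℂ) +
      ((2 * Real.pi * (((n 0 : ℝ) - n 1) - (m 0 - m 1)) * v 0 : ℝ) : ℂ) * Complex.I := by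
  simp only [frequencyForm, map_sub, map_mul, MvPolynomial.aeval_C, MvPolynomial.aeval_X,
    Algebra.algebraMap_self, RingHom.id_apply]
  push_cast
  ring

/-- The real part sees `y` through the difference of the sums `m 0 + m 1`, the imaginary part sees
`x` through that of `m 0 - m 1`; for `m ≠ n` one of these differences is nonzero. -/
theorem coordinate_constant_of_frequencyForm_constant {m n : Fin 2 →₀ ℕ} (hmn : m ≠ n)
    {U : Set (Fin 2 → ℝ)} {κ : ℂ} (hU : ∀ v ∈ U,
      MvPolynomial.aeval (fun i ↦ (v i : ℂ)) (frequencyForm n - frequencyForm m) = κ) :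
    ∃ i, ∀ v ∈ U, ∀ w ∈ U, v i = w i := by
  have hre : ∀ v ∈ U, ∀ w ∈ U,
      (((n 0 : ℝ) + n 1) - (m 0 + m 1)) * v 1 = (((n 0 : ℝ) + n 1) - (m 0 + m 1)) * w 1 ∧
      (((n 0 : ℝ) - n 1) - (m 0 - m 1)) * v 0 = (((n 0 : ℝ) - n 1) - (m 0 - m 1)) * w 0 := by
    intro v hv w hw
    have h := (hU v hv).trans (hU w hw).symm
    rw [aeval_frequencyForm_sub, aeval_frequencyForm_sub, ← sub_eq_zero] at h
    have h' := ofReal_add_mul_I_eq_zero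
      (x := -(2 * Real.pi * (((n 0 : ℝ) + n 1) - (m 0 + m 1)) * v 1) -
        -(2 * Real.pi * (((n 0 : ℝ) + n 1) - (m 0 + m 1)) * w 1))
      (y := 2 * Real.pi * (((n 0 : ℝ) - n 1) - (m 0 - m 1)) * v 0 -
        2 * Real.pi * (((n 0 : ℝ) - n 1) - (m 0 - m 1)) * w 0)
    obtain ⟨h1, h2⟩ := h'.1 (by rw [← h]; push_cast; ring)
    have hpi : (2 * Real.pi) ≠ 0 := by positivity
    constructor
    · apply mul_left_cancel₀ hpi; linarith
    · apply mul_left_cancel₀ hpi; linarith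
  by_cases h0 : ((n 0 : ℝ) + n 1) - (m 0 + m 1) = 0
  · refine ⟨0, fun v hv w hw ↦ mul_left_cancel₀ (fun h1 ↦ hmn ?_) (hre v hv w hw).2⟩
    have e0 : (m 0 : ℝ) = n 0 := by linarith
    have e1 : (m 1 : ℝ) = n 1 := by linarith
    ext i
    fin_cases i
    · exact_mod_cast e0
    · exact_mod_cast e1
  · exact ⟨1, fun v hv w hw ↦ mul_left_cancel₀ h0 (hre v hv w hw).1⟩

/-- An irreducible real algebraic set containing infinitely many points of an axis-parallel line is
that line. -/
theorem eq_line_of_infinite {T U : Set (Fin 2 → ℝ)} [hT : (pointIdeal T).IsPrime]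
    (hT0 : pointIdeal T ≠ ⊥)
    (hTz : ∀ v, (∀ f ∈ pointIdeal T, MvPolynomial.aeval v f = 0) → v ∈ T)
    (hUT : U ⊆ T) (hU : U.Infinite) {i : Fin 2} {a : ℝ} (hUa : ∀ v ∈ U, v i = a) :
    T = {v | v i = a} := by
  refine Set.Subset.antisymm (fun v hv ↦ ?_) fun v hv ↦ hTz v fun f hf ↦ ?_
  · have := mem_pointIdeal_of_infinite hT0 hUT hU
      (f := MvPolynomial.X i - MvPolynomial.C a) fun v hv ↦ by simp [hUa v hv]
    have := mem_pointIdeal.1 this v hv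
    rw [map_sub, MvPolynomial.aeval_X, MvPolynomial.aeval_C] at this
    exact sub_eq_zero.1 this
  · let F : Polynomial ℝ := MvPolynomial.aeval
      (fun j ↦ if j = i then Polynomial.C a else Polynomial.X) f
    have hF : ∀ w : Fin 2 → ℝ, w i = a → F.eval (w (1 - i)) = MvPolynomial.aeval w f := by
      intro w hw
      have : F.eval (w (1 - i)) = Polynomial.aeval (w (1 - i)) F := by simp [Polynomial.aeval_def]
      rw [this, MvPolynomial.comp_aeval_apply]
      congr 2
      funext j
      subst hw
      fin_cases i <;> fin_cases j <;> simp
    have hF0 : F = 0 := by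
      refine Polynomial.eq_zero_of_infinite_isRoot F
        ((hU.image (f := fun w ↦ w (1 - i)) ?_).mono ?_)
      · intro v hv w hw hvw
        have h1 := (hUa v hv).trans (hUa w hw).symm
        funext j
        fin_cases i <;> fin_cases j <;> simp_all
      · rintro _ ⟨w, hw, rfl⟩
        rw [Set.mem_ofPred_eq, Polynomial.IsRoot, hF w (hUa w hw)]
        exact mem_pointIdeal.1 hf w (hUT hw)
    rw [← hF v hv, hF0, Polynomial.eval_zero]

/-- Ax–Lindemann for `ℝ² → ℂˣ`: an infinite irreducible real algebraic curve whose image under the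
exponential satisfies an algebraic equation is an axis-parallel line. -/
theorem eq_line_of_exp_relation {T : Set (Fin 2 → ℝ)} [hT : (pointIdeal T).IsPrime]
    (hT0 : pointIdeal T ≠ ⊥) (hTi : T.Infinite)
    (hTz : ∀ v, (∀ f ∈ pointIdeal T, MvPolynomial.aeval v f = 0) → v ∈ T)
    {q : MvPolynomial (Fin 2) ℝ} (hq : q ≠ 0)
    (hqT : ∀ v ∈ T, MvPolynomial.aeval (realCoords
      (Complex.exp (2 * Real.pi * Complex.I * (v 0 + v 1 * Complex.I)))) q = 0) :
    ∃ i a, T = {v | v i = a} := by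
  obtain ⟨γ, d, α, β, hαβ, hγ⟩ := exists_regular_arc hT0 hTi hTz
  have hinf : ∀ a b, a < b → Set.Ioo a b ⊆ Set.Ioo α β → (γ '' Set.Ioo a b).Infinite :=
    fun a b hab hsub ↦ infinite_image_regular_arc hab fun t ht ↦ (hγ t (hsub ht)).2
  have hsubT : ∀ a b, Set.Ioo a b ⊆ Set.Ioo α β → γ '' Set.Ioo a b ⊆ T := by
    rintro a b hsub _ ⟨t, ht, rfl⟩
    exact (hγ t (hsub ht)).1
  obtain ⟨Q, hQ0, hQ⟩ := exists_conj_polynomial hq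
  have := complexPointIdeal_isPrime (T := T)
  have hC0 : complexPointIdeal T ≠ ⊥ := by
    obtain ⟨p, hpT, hp0⟩ := Submodule.exists_mem_ne_zero_of_ne_bot hT0
    refine (Submodule.ne_bot_iff _).2 ⟨MvPolynomial.map Complex.ofRealHom p,
      mem_complexPointIdeal.2 fun v hv ↦ ?_, fun h ↦ hp0 ?_⟩
    · rw [aeval_map_ofReal, mem_pointIdeal.1 hpT v hv, Complex.ofReal_zero]
    · exact MvPolynomial.map_injective Complex.ofRealHom Complex.ofReal_injective
        (by rw [h, map_zero])
  obtain ⟨v₀, hv₀⟩ := hTi.nonempty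
  obtain ⟨m, -, n, -, hmn, a, b, hab, hsub, κ, hκ⟩ := exists_exponent_sub_constant
    (w := fun t i ↦ (γ t i : ℂ)) (d := fun i ↦ MvPolynomial.map Complex.ofRealHom (d i))
    (P := complexPointIdeal T) (fun t ht i ↦ by
      rw [aeval_map_ofReal]; exact ((hγ t ht).2.1 i).ofReal_comp) hC0
    (fun c hc t ht ↦ mem_complexPointIdeal.1 hc _ (hγ t ht).1)
    (fun a b hab hsub c hc ↦ mem_complexPointIdeal_of_infinite hT0 (hsubT a b hsub)
      (hinf a b hab hsub) (by rintro _ ⟨t, ht, rfl⟩; exact hc t ht)) hαβ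
    frequencyForm Q.support (Finset.nonempty_iff_ne_empty.2 (MvPolynomial.support_eq_empty.not.2 hQ0))
    (fun m ↦ MvPolynomial.C (Q.coeff m))
    (fun m hm h ↦ by
      have := mem_complexPointIdeal.1 h v₀ hv₀
      rw [MvPolynomial.aeval_C] at this
      exact MvPolynomial.mem_support_iff.1 hm this)
    (fun t ht ↦ by
      rw [← aeval_exp_eq_sum Q (γ t), hQ, hqT _ (hγ t ht).1, Complex.ofReal_zero])
  obtain ⟨i, hi⟩ := coordinate_constant_of_frequencyForm_constant hmn
    (U := γ '' Set.Ioo a b) (κ := κ) (by rintro _ ⟨t, ht, rfl⟩; exact hκ t ht)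
  obtain ⟨t₀, ht₀⟩ := Set.nonempty_Ioo.2 hab
  exact ⟨i, γ t₀ i, eq_line_of_infinite hT0 hTz (hsubT a b hsub) (hinf a b hab hsub)
    fun v hv ↦ hi v hv _ ⟨t₀, ht₀, rfl⟩⟩

/-! ### Real points as zeros of polynomials. -/

theorem realCoords_injective : Function.Injective realCoords :=
  fun _ _ h ↦ Complex.ext (congrFun h 0) (congrFun h 1)

theorem mem_planePoints_zeroLocus {s : Set PlaneRing} {z : ℂ} :
    z ∈ planePoints (PrimeSpectrum.zeroLocus s) ↔
      ∀ f ∈ s, MvPolynomial.aeval (realCoords z) f = 0 := by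
  constructor
  · rintro ⟨φ, hφ, h0, h1⟩ f hf
    have : φ = MvPolynomial.aeval (realCoords z) := by
      refine MvPolynomial.algHom_ext fun i ↦ ?_
      fin_cases i
      · simpa [realCoords] using h0
      · simpa [realCoords] using h1
    rw [← this]
    exact hφ hf
  · intro h
    exact ⟨MvPolynomial.aeval (realCoords z), fun f hf ↦ h f hf, by simp [realCoords],
      by simp [realCoords]⟩

theorem exists_prime_torusPoints {W : Set (PrimeSpectrum TorusRing)} (hc : IsClosed W)
    (hi : IsIrreducible W) (hp : W ≠ Set.univ) :
    ∃ P : Ideal PlaneRing, P.IsPrime ∧ P ≠ ⊥ ∧ ∀ z : ℂˣ,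
      z ∈ torusPoints W ↔ ∀ f ∈ P, MvPolynomial.aeval (realCoords z) f = 0 := by
  set 𝔭 := PrimeSpectrum.vanishingIdeal W
  have h𝔭 : 𝔭.IsPrime := PrimeSpectrum.isIrreducible_iff_vanishingIdeal_isPrime.1 hi
  have hW : W = PrimeSpectrum.zeroLocus 𝔭 := by
    rw [PrimeSpectrum.zeroLocus_vanishingIdeal_eq_closure, hc.closure_eq]
  let r : PlaneRing := MvPolynomial.X 0 ^ 2 + MvPolynomial.X 1 ^ 2
  refine ⟨𝔭.comap (algebraMap PlaneRing TorusRing), h𝔭.comap _, fun h ↦ hp ?_, fun z ↦ ?_⟩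
  -- An ideal of a localization is extended from its contraction, so a zero contraction would make
  -- `W` everything.
  · have := IsLocalization.map_under (Submonoid.powers r) TorusRing 𝔭
    rw [Ideal.under_def, h, Ideal.map_bot] at this
    rw [hW, ← this]
    simp
  constructor
  · rintro ⟨φ, hφ, h0, h1⟩ f hf
    have hc : φ.comp (Algebra.algHom ℝ PlaneRing TorusRing) =
        MvPolynomial.aeval (realCoords z) := by
      refine MvPolynomial.algHom_ext fun i ↦ ?_
      fin_cases i
      · exact h0.trans (by simp [realCoords])
      · exact h1.trans (by simp [realCoords])
    rw [← hc]
    rw [hW] at hφ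
    exact hφ hf
  · intro h
    have hz : MvPolynomial.aeval (realCoords z) r ≠ 0 := by
      have := Complex.normSq_pos.2 z.ne_zero
      rw [Complex.normSq_apply] at this
      simp only [r, realCoords, map_add, map_pow, MvPolynomial.aeval_X, Matrix.cons_val_zero,
        Matrix.cons_val_one]
      nlinarith
    have hu : ∀ y : Submonoid.powers r, IsUnit (MvPolynomial.aeval (realCoords z) (y : PlaneRing)) := by
      rintro ⟨_, n, rfl⟩
      simpa using fun h ↦ absurd h hz
    let φ : TorusRing →ₐ[ℝ] ℝ := IsLocalization.liftAlgHom (M := Submonoid.powers r) hu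
    have hφ : ∀ f, φ (algebraMap PlaneRing TorusRing f) = MvPolynomial.aeval (realCoords z) f :=
      fun f ↦ by simp [φ]
    refine ⟨φ, ?_, by rw [hφ]; simp [realCoords], by rw [hφ]; simp [realCoords]⟩
    rw [hW]
    intro g hg
    obtain ⟨⟨f, s⟩, hfs⟩ := IsLocalization.surj (Submonoid.powers r) g
    have hf : f ∈ 𝔭.comap (algebraMap PlaneRing TorusRing) := by
      rw [Ideal.mem_comap, ← hfs]
      exact Ideal.mul_mem_right _ _ hg
    have h1 := congrArg φ hfs
    rw [map_mul, hφ, hφ, h f hf] at h1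
    exact (mul_eq_zero.1 h1).resolve_right (hu s).ne_zero

/-! ### Horizontal lines and circles. -/

theorem coe_expMap (z : ℂ) : (expMap z : ℂ) = Complex.exp (2 * Real.pi * Complex.I * z) := rfl

theorem norm_expMap (z : ℂ) : ‖(expMap z : ℂ)‖ = Real.exp (-(2 * Real.pi * z.im)) := by
  rw [coe_expMap, Complex.norm_exp]
  simp

theorem expMap_image_horizontal_line (a : ℝ) :
    expMap '' {z | z.im = a} = {z : ℂˣ | ‖(z : ℂ)‖ = Real.exp (-(2 * Real.pi * a))} := by
  ext z
  constructor
  · rintro ⟨w, hw, rfl⟩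
    have hw' : w.im = a := hw
    rw [Set.mem_ofPred_eq, norm_expMap, hw']
  · intro hz
    have hz' : ‖(z : ℂ)‖ = Real.exp (-(2 * Real.pi * a)) := hz
    refine ⟨Complex.log z / (2 * Real.pi * Complex.I), ?_, ?_⟩
    · have hpi : (2 * Real.pi) ≠ 0 := by positivity
      have : Complex.log z / (2 * Real.pi * Complex.I) =
          -(Complex.I * Complex.log z) / (2 * Real.pi : ℝ) := by
        rw [div_eq_div_iff Complex.two_pi_I_ne_zero (by exact_mod_cast hpi)]
        push_cast
        linear_combination (2 * Real.pi * Complex.log z) * Complex.I_sq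
      rw [Set.mem_ofPred_eq, this, Complex.div_ofReal_im]
      simp only [Complex.neg_im, Complex.I_mul_im, Complex.log_re, hz', Real.log_exp]
      field_simp
    · apply Units.ext
      rw [coe_expMap, mul_div_cancel₀ _ Complex.two_pi_I_ne_zero, Complex.exp_log z.ne_zero]

theorem mul_image_unitCircle (g : ℂˣ) :
    (fun z ↦ g * z) '' unitCircle = {z : ℂˣ | ‖(z : ℂ)‖ = ‖(g : ℂ)‖} := by
  ext z
  constructor
  · rintro ⟨w, hw, rfl⟩
    have hw' : ‖(w : ℂ)‖ = 1 := hw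
    simp [hw']
  · intro hz
    have hz' : ‖(z : ℂ)‖ = ‖(g : ℂ)‖ := hz
    refine ⟨g⁻¹ * z, ?_, by simp⟩
    have : ‖(g : ℂ)‖ ≠ 0 := norm_ne_zero_iff.2 g.ne_zero
    simp [unitCircle, hz', this]

/-! ### Strongly bialgebraic sets and their vanishing ideals. -/

/-- The set of real coordinate pairs of the points of a subset of the complex plane. -/
def coordSet (S : Set ℂ) : Set (Fin 2 → ℝ) := {v | (v 0 + v 1 * Complex.I : ℂ) ∈ S}

theorem realCoords_add_mul_I (v : Fin 2 → ℝ) : realCoords (v 0 + v 1 * Complex.I) = v := by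
  funext i
  fin_cases i <;> simp [realCoords]

theorem realCoords_mem_coordSet {S : Set ℂ} {z : ℂ} : realCoords z ∈ coordSet S ↔ z ∈ S := by
  simp [coordSet, realCoords]

theorem mem_pointIdeal_coordSet {S : Set ℂ} {f : PlaneRing} :
    f ∈ pointIdeal (coordSet S) ↔ ∀ z ∈ S, MvPolynomial.aeval (realCoords z) f = 0 := by
  rw [mem_pointIdeal]
  refine ⟨fun h z hz ↦ h _ (realCoords_mem_coordSet.2 hz), fun h v hv ↦ ?_⟩
  rw [← realCoords_add_mul_I v]
  exact h _ hv

theorem IsStronglyBialgebraic.mem_of_pointIdeal {S : Set ℂ} (hS : IsStronglyBialgebraic S)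
    {v : Fin 2 → ℝ} (hv : ∀ f ∈ pointIdeal (coordSet S), MvPolynomial.aeval v f = 0) :
    v ∈ coordSet S := by
  obtain ⟨V, hV, hSV⟩ := hS.algebraic
  obtain ⟨s, rfl⟩ := (PrimeSpectrum.isClosed_iff_zeroLocus V).1 hV
  change _ ∈ S
  rw [hSV, mem_planePoints_zeroLocus]
  intro f hf
  rw [realCoords_add_mul_I]
  refine hv f (mem_pointIdeal_coordSet.2 fun z hz ↦ ?_)
  rw [hSV, mem_planePoints_zeroLocus] at hz
  exact hz f hf

theorem IsStronglyBialgebraic.pointIdeal_ne_bot {S : Set ℂ} (hS : IsStronglyBialgebraic S) :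
    pointIdeal (coordSet S) ≠ ⊥ := by
  intro h
  refine hS.ne_univ (Set.eq_univ_of_forall fun z ↦ realCoords_mem_coordSet.1
    (hS.mem_of_pointIdeal fun f hf ↦ ?_))
  rw [h, Ideal.mem_bot] at hf
  rw [hf, map_zero]

/-- If `f g` vanishes on `S` but neither factor does, then `S ∩ {f = 0}` and `S ∩ {g = 0}` form a
forbidden decomposition. -/
theorem IsStronglyBialgebraic.pointIdeal_isPrime {S : Set ℂ} (hS : IsStronglyBialgebraic S)
    (hne : S.Nonempty) : (pointIdeal (coordSet S)).IsPrime := by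
  refine ⟨fun h ↦ ?_, fun {f g} hfg ↦ ?_⟩
  · obtain ⟨z, hz⟩ := hne
    have := mem_pointIdeal_coordSet.1 ((Ideal.eq_top_iff_one _).1 h) z hz
    simp at this
  · by_contra! hcon
    obtain ⟨V, hV, hSV⟩ := hS.algebraic
    obtain ⟨s, rfl⟩ := (PrimeSpectrum.isClosed_iff_zeroLocus V).1 hV
    have hmem : ∀ (h : PlaneRing) z, z ∈ planePoints (PrimeSpectrum.zeroLocus (insert h s)) ↔
        MvPolynomial.aeval (realCoords z) h = 0 ∧ z ∈ S := by
      intro h z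
      rw [hSV, mem_planePoints_zeroLocus, mem_planePoints_zeroLocus, Set.forall_mem_insert]
    have hss : ∀ h : PlaneRing, h ∉ pointIdeal (coordSet S) →
        planePoints (PrimeSpectrum.zeroLocus (insert h s)) ⊂ S := by
      intro h hh
      rw [mem_pointIdeal_coordSet] at hh
      push Not at hh
      obtain ⟨z, hz, hzh⟩ := hh
      exact ⟨fun w hw ↦ ((hmem h w).1 hw).2, fun hsub ↦ hzh ((hmem h z).1 (hsub hz)).1⟩
    refine hS.irreducible ⟨_, _, PrimeSpectrum.isClosed_zeroLocus (insert f s),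
      PrimeSpectrum.isClosed_zeroLocus (insert g s), hss f hcon.1, hss g hcon.2, ?_⟩
    refine Set.Subset.antisymm (fun z hz ↦ ?_)
      (Set.union_subset (hss f hcon.1).subset (hss g hcon.2).subset)
    have := mem_pointIdeal_coordSet.1 hfg z hz
    rw [map_mul, mul_eq_zero] at this
    exact this.imp (fun h ↦ (hmem f z).2 ⟨h, hz⟩) fun h ↦ (hmem g z).2 ⟨h, hz⟩

theorem infinite_of_pointIdeal_isPrime {T : Set (Fin 2 → ℝ)} [hT : (pointIdeal T).IsPrime]
    (hT' : T.Nontrivial) : T.Infinite := by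
  intro hfin
  -- `F v` has `v` as its only real zero. On a finite `T` the product of these vanishes, so by
  -- primality a single factor would vanish on all of `T`.
  let F : (Fin 2 → ℝ) → MvPolynomial (Fin 2) ℝ := fun v ↦
    (MvPolynomial.X 0 - MvPolynomial.C (v 0)) ^ 2 + (MvPolynomial.X 1 - MvPolynomial.C (v 1)) ^ 2
  have hF : ∀ v w, MvPolynomial.aeval w (F v) = (w 0 - v 0) ^ 2 + (w 1 - v 1) ^ 2 := by
    intro v w
    simp [F]
  have hprod : ∏ v ∈ hfin.toFinset, F v ∈ pointIdeal T := by
    refine mem_pointIdeal.2 fun w hw ↦ ?_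
    rw [map_prod]
    exact Finset.prod_eq_zero (hfin.mem_toFinset.2 hw) (by rw [hF]; ring)
  obtain ⟨v, -, hv⟩ := (hT.prod_mem_iff).1 hprod
  obtain ⟨w, hw, hwv⟩ := hT'.exists_ne v
  have := mem_pointIdeal.1 hv w hw
  rw [hF, add_eq_zero_iff_of_nonneg (sq_nonneg _) (sq_nonneg _)] at this
  refine hwv (funext fun i ↦ ?_)
  fin_cases i
  · exact sub_eq_zero.1 (pow_eq_zero_iff two_ne_zero |>.1 this.1)
  · exact sub_eq_zero.1 (pow_eq_zero_iff two_ne_zero |>.1 this.2)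

theorem isStronglyBialgebraic_horizontal_line (a : ℝ) {W : Set (PrimeSpectrum TorusRing)}
    (hW : IsClosed W) (h : expMap '' {z | z.im = a} = torusPoints W) :
    IsStronglyBialgebraic {z | z.im = a} where
  ne_univ h := by
    have : ((a + 1 : ℝ) * Complex.I : ℂ) ∈ {z : ℂ | z.im = a} := h ▸ Set.mem_univ _
    simp at this
  algebraic := by
    refine ⟨PrimeSpectrum.zeroLocus {MvPolynomial.X 1 - MvPolynomial.C a},
      PrimeSpectrum.isClosed_zeroLocus _, ?_⟩
    ext z
    rw [mem_planePoints_zeroLocus]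
    simp [realCoords, sub_eq_zero]
  algebraic_image := ⟨W, hW, h⟩
  irreducible := by
    rintro ⟨V₁, V₂, h₁, h₂, hs₁, hs₂, hU⟩
    -- A proper algebraic subset of the line lies in the zeros of a nonzero one-variable polynomial,
    -- and two such sets cannot cover the line.
    have key : ∀ V, IsClosed V → planePoints V ⊂ {z : ℂ | z.im = a} →
        ∃ F : Polynomial ℝ, F ≠ 0 ∧ ∀ x : ℝ, (x + a * Complex.I : ℂ) ∈ planePoints V →
          F.eval x = 0 := by
      intro V hV hs
      obtain ⟨s, rfl⟩ := (PrimeSpectrum.isClosed_iff_zeroLocus V).1 hV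
      obtain ⟨z, hz, hzV⟩ := Set.exists_of_ssubset hs
      rw [mem_planePoints_zeroLocus] at hzV
      push Not at hzV
      obtain ⟨f, hf, hfz⟩ := hzV
      let F : Polynomial ℝ := MvPolynomial.aeval ![Polynomial.X, Polynomial.C a] f
      have hF : ∀ w : ℂ, w.im = a → F.eval w.re = MvPolynomial.aeval (realCoords w) f := by
        intro w hw
        have : F.eval w.re = Polynomial.aeval w.re F := by simp [Polynomial.aeval_def]
        rw [this, MvPolynomial.comp_aeval_apply]
        congr 2
        funext j
        fin_cases j <;> simp [realCoords, hw]
      refine ⟨F, fun h0 ↦ hfz ?_, fun x hx ↦ ?_⟩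
      · rw [← hF z hz, h0, Polynomial.eval_zero]
      · have := hF (x + a * Complex.I) (by simp)
        rw [mem_planePoints_zeroLocus.1 hx f hf] at this
        simpa using this
    obtain ⟨F₁, hF₁, hx₁⟩ := key V₁ h₁ hs₁
    obtain ⟨F₂, hF₂, hx₂⟩ := key V₂ h₂ hs₂
    refine mul_ne_zero hF₁ hF₂ (Polynomial.funext fun x ↦ ?_)
    have : (x + a * Complex.I : ℂ) ∈ planePoints V₁ ∪ planePoints V₂ := by
      rw [← hU]
      simp
    rw [Polynomial.eval_mul, Polynomial.eval_zero, mul_eq_zero]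
    exact this.imp (hx₁ x) (hx₂ x)

/-- The image is an open ray from `0`. A polynomial vanishing on it vanishes on the whole real line
through it, hence at `-expMap a`, which is off the ray. -/
theorem expMap_image_vertical_line_ne {a : ℝ} {P : Set PlaneRing}
    (h : ∀ z : ℂˣ, z ∈ expMap '' {z | z.re = a} ↔
      ∀ f ∈ P, MvPolynomial.aeval (realCoords z) f = 0) : False := by
  have hexp : ∀ y : ℝ, (expMap (a + y * Complex.I) : ℂ) =
      (Real.exp (-(2 * Real.pi * y)) : ℝ) * (expMap a : ℂ) := by
    intro y
    rw [coe_expMap, coe_expMap, Complex.ofReal_exp, ← Complex.exp_add]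
    congr 1
    push_cast
    linear_combination (2 * Real.pi * y) * Complex.I_sq
  have hneg : -expMap a ∈ expMap '' {z | z.re = a} := by
    refine (h _).2 fun f hf ↦ ?_
    let F : Polynomial ℝ := MvPolynomial.aeval
      (fun i ↦ Polynomial.C (realCoords (expMap a) i) * Polynomial.X) f
    have hF : ∀ r : ℝ, F.eval r = MvPolynomial.aeval (realCoords (r * (expMap a : ℂ))) f := by
      intro r
      have : F.eval r = Polynomial.aeval r F := by simp [Polynomial.aeval_def]
      rw [this, MvPolynomial.comp_aeval_apply]
      congr 2
      funext j
      fin_cases j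
      · simp only [realCoords, map_mul, Polynomial.aeval_C, Polynomial.aeval_X,
          Complex.re_ofReal_mul]
        exact mul_comm _ _
      · simp only [realCoords, map_mul, Polynomial.aeval_C, Polynomial.aeval_X,
          Complex.im_ofReal_mul]
        exact mul_comm _ _
    have hF0 : F = 0 := by
      refine Polynomial.eq_zero_of_infinite_isRoot F ((Set.Ioi_infinite (0 : ℝ)).mono ?_)
      intro r hr
      have hr' : 0 < r := hr
      have hpi : (2 * Real.pi) ≠ 0 := by positivity
      have hmem := (h (expMap (a + (-(Real.log r) / (2 * Real.pi) : ℝ) * Complex.I))).1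
        ⟨_, by
          rw [Set.mem_ofPred_eq, Complex.add_re, Complex.re_ofReal_mul]; simp, rfl⟩ f hf
      have hr2 : Real.exp (-(2 * Real.pi * (-(Real.log r) / (2 * Real.pi)))) = r := by
        rw [mul_div_cancel₀ _ hpi, neg_neg, Real.exp_log hr']
      rw [hexp, hr2] at hmem
      rw [Set.mem_ofPred_eq, Polynomial.IsRoot, hF]
      exact hmem
    have := hF (-1)
    rw [hF0, Polynomial.eval_zero] at this
    rw [this]
    simp
  obtain ⟨z, hz, hze⟩ := hneg
  have hz' : z.re = a := hz
  have hzz : z = a + z.im * Complex.I := by rw [← hz', Complex.re_add_im]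
  have h1 := congrArg (fun u : ℂˣ ↦ (u : ℂ)) hze
  simp only [Units.val_neg] at h1
  rw [hzz, hexp] at h1
  have h2 : ((Real.exp (-(2 * Real.pi * z.im)) + 1 : ℝ) : ℂ) * (expMap a : ℂ) = 0 := by
    push_cast
    push_cast at h1
    linear_combination h1
  have h3 : Real.exp (-(2 * Real.pi * z.im)) + 1 = 0 :=
    Complex.ofReal_eq_zero.1 ((mul_eq_zero.1 h2).resolve_right (expMap a).ne_zero)
  linarith [Real.exp_pos (-(2 * Real.pi * z.im))]

theorem IsStronglyBialgebraic.eq_horizontal_line {S : Set ℂ} (hS : IsStronglyBialgebraic S)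
    (hSn : S.Nontrivial) {P : Ideal PlaneRing} (hP : P ≠ ⊥)
    (h : ∀ z : ℂˣ, z ∈ expMap '' S ↔ ∀ f ∈ P, MvPolynomial.aeval (realCoords z) f = 0) :
    ∃ a : ℝ, S = {z | z.im = a} := by
  have hprime := hS.pointIdeal_isPrime hSn.nonempty
  have hn : (coordSet S).Nontrivial := by
    obtain ⟨z, hz, w, hw, hzw⟩ := hSn
    exact ⟨_, realCoords_mem_coordSet.2 hz, _, realCoords_mem_coordSet.2 hw,
      realCoords_injective.ne hzw⟩
  obtain ⟨q, hqP, hq0⟩ := Submodule.exists_mem_ne_zero_of_ne_bot hP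
  obtain ⟨i, a, hT⟩ := eq_line_of_exp_relation hS.pointIdeal_ne_bot
    (infinite_of_pointIdeal_isPrime hn) (fun v hv ↦ hS.mem_of_pointIdeal hv) hq0
    (fun v hv ↦ (h (expMap (v 0 + v 1 * Complex.I))).1 ⟨_, hv, rfl⟩ q hqP)
  have hSa : S = {z | realCoords z i = a} := by
    ext z
    rw [← realCoords_mem_coordSet, hT]
    rfl
  fin_cases i
  · exfalso
    refine expMap_image_vertical_line_ne (a := a) (P := P) fun z ↦ ?_
    have : S = {z | z.re = a} := hSa
    rw [← this]
    exact h z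
  · exact ⟨a, hSa⟩

/-! ### Special points and the main theorem. -/

theorem infinite_isSpecialPoint_unitCircle :
    {z | z ∈ unitCircle ∧ IsSpecialPoint z}.Infinite := by
  have hprim : ∀ n : ℕ, IsPrimitiveRoot
      (Units.mk0 (Complex.exp (2 * Real.pi * Complex.I / (n + 1 : ℕ))) (Complex.exp_ne_zero _))
      (n + 1) := fun n ↦
    IsPrimitiveRoot.coe_units_iff.1 (Complex.isPrimitiveRoot_exp (n + 1) n.succ_ne_zero)
  refine (Set.infinite_range_of_injective (f := fun n : ℕ ↦
    Units.mk0 (Complex.exp (2 * Real.pi * Complex.I / (n + 1 : ℕ))) (Complex.exp_ne_zero _))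
    fun m n hmn ↦ ?_).mono ?_
  · have h1 := (hprim m).eq_orderOf
    have h2 := (hprim n).eq_orderOf
    simp only at hmn
    rw [hmn, ← h2] at h1
    exact Nat.succ_injective h1
  · rintro _ ⟨n, rfl⟩
    refine ⟨?_, isOfFinOrder_iff_pow_eq_one.2 ⟨n + 1, n.succ_pos, (hprim n).pow_eq_one⟩⟩
    exact Complex.norm_eq_one_of_pow_eq_one
      (by simpa using congrArg Units.val (hprim n).pow_eq_one) n.succ_ne_zero

theorem IsSpecialPoint.norm_eq_one {z : ℂˣ} (hz : IsSpecialPoint z) : ‖(z : ℂ)‖ = 1 := by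
  obtain ⟨n, hn, h⟩ := isOfFinOrder_iff_pow_eq_one.1 hz
  exact Complex.norm_eq_one_of_pow_eq_one (by simpa using congrArg Units.val h) hn.ne'

/-- A polynomial with infinitely many zeros on the unit circle vanishes on the unit circle. -/
theorem aeval_eq_zero_of_infinite_zeros_unitCircle {f : PlaneRing} {U : Set ℂˣ}
    (hU : U.Infinite) (hU1 : U ⊆ unitCircle)
    (hf : ∀ z ∈ U, MvPolynomial.aeval (realCoords z) f = 0) :
    ∀ z ∈ unitCircle, MvPolynomial.aeval (realCoords z) f = 0 := by
  have han : ∀ f : PlaneRing, AnalyticOnNhd ℝ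
      (fun θ : ℝ ↦ MvPolynomial.aeval ![Real.cos θ, Real.sin θ] f) Set.univ := by
    intro f
    induction f using MvPolynomial.induction_on with
    | C c => simpa using analyticOnNhd_const
    | add p q hp hq =>
      simp only [map_add]
      exact hp.add hq
    | mul_X p i hp =>
      simp only [map_mul, MvPolynomial.aeval_X]
      refine hp.mul ?_
      fin_cases i
      · exact fun x _ ↦ Real.analyticAt_cos
      · exact fun x _ ↦ Real.analyticAt_sin
  have hcoord : ∀ z ∈ unitCircle, ![Real.cos (z : ℂ).arg, Real.sin (z : ℂ).arg] =
      realCoords z := by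
    intro z hz
    have hz' : ‖(z : ℂ)‖ = 1 := hz
    rw [Complex.cos_arg z.ne_zero, Complex.sin_arg, hz', div_one, div_one]
    rfl
  have hinf : ((fun z : ℂˣ ↦ (z : ℂ).arg) '' U).Infinite := by
    refine hU.image fun z hz w hw hzw ↦ Units.ext (realCoords_injective ?_)
    rw [← hcoord z (hU1 hz), ← hcoord w (hU1 hw)]
    rw [show (z : ℂ).arg = (w : ℂ).arg from hzw]
  -- Infinitely many arguments in `[-π, π]` accumulate, so the identity theorem applies to the
  -- function of `θ`.
  obtain ⟨θ, -, hθ⟩ := hinf.exists_accPt_of_subset_isCompact (isCompact_Icc (a := -Real.pi)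
    (b := Real.pi)) (by
      rintro _ ⟨z, -, rfl⟩
      exact ⟨(Complex.neg_pi_lt_arg _).le, Complex.arg_le_pi _⟩)
  have hzero := (han f).eq_of_frequently_eq (g := fun _ ↦ 0) (fun x _ ↦ analyticAt_const)
    (z₀ := θ) ((accPt_iff_frequently_nhdsNE.1 hθ).mono (by
      rintro _ ⟨z, hz, rfl⟩
      rw [hcoord z (hU1 hz)]
      exact hf z hz))
  intro z hz
  rw [← hcoord z hz]
  exact congrFun hzero _

theorem mainTheorem8 (W : Set (PrimeSpectrum TorusRing)) (hW_closed : IsClosed W)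
    (hW_irred : IsIrreducible W) (hW_proper : W ≠ Set.univ)
    (hW_points : (torusPoints W).Nontrivial) :
    ((∃ S : Set ℂ, IsStronglyBialgebraic S ∧ torusPoints W = expMap '' S) ↔
      ∃ g : ℂˣ, torusPoints W = (fun z => g * z) '' unitCircle) ∧
    ((∃ S : Set ℂ, IsStronglyBialgebraic S ∧ torusPoints W = expMap '' S) →
      ((∃ z ∈ torusPoints W, IsSpecialPoint z) ↔
        {z | z ∈ torusPoints W ∧ IsSpecialPoint z}.Infinite)) ∧
    ({z | z ∈ torusPoints W ∧ IsSpecialPoint z}.Infinite →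
      torusPoints W = unitCircle) := by
  obtain ⟨P, hP, hP0, hWP⟩ := exists_prime_torusPoints hW_closed hW_irred hW_proper
  have himp : (∃ S : Set ℂ, IsStronglyBialgebraic S ∧ torusPoints W = expMap '' S) →
      ∃ g : ℂˣ, torusPoints W = (fun z => g * z) '' unitCircle := by
    rintro ⟨S, hS, hWS⟩
    have hSn : S.Nontrivial := Set.nontrivial_of_image expMap S (hWS ▸ hW_points)
    obtain ⟨a, rfl⟩ := hS.eq_horizontal_line hSn hP0 fun z ↦ by rw [← hWS, hWP]
    refine ⟨expMap (a * Complex.I), ?_⟩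
    rw [hWS, expMap_image_horizontal_line, mul_image_unitCircle, norm_expMap]
    simp
  refine ⟨⟨himp, ?_⟩, fun hS ↦ ⟨?_, fun h ↦ ?_⟩, fun h ↦ ?_⟩
  · rintro ⟨g, hg⟩
    have hpi : (2 * Real.pi) ≠ 0 := by positivity
    have hWS : torusPoints W =
        expMap '' {z | z.im = -Real.log ‖(g : ℂ)‖ / (2 * Real.pi)} := by
      rw [hg, mul_image_unitCircle, expMap_image_horizontal_line, mul_div_cancel₀ _ hpi, neg_neg,
        Real.exp_log (norm_pos_iff.2 g.ne_zero)]
    exact ⟨_, isStronglyBialgebraic_horizontal_line _ hW_closed hWS.symm, hWS⟩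
  · rintro ⟨z, hz, hzs⟩
    obtain ⟨g, hg⟩ := himp hS
    have hWc : torusPoints W = unitCircle := by
      rw [hg, mul_image_unitCircle] at hz ⊢
      have hz' : ‖(z : ℂ)‖ = ‖(g : ℂ)‖ := hz
      rw [← hz', hzs.norm_eq_one]
      rfl
    rw [hWc]
    exact infinite_isSpecialPoint_unitCircle
  · obtain ⟨z, hz, hzs⟩ := h.nonempty
    exact ⟨z, hz, hzs⟩
  · have hU1 : {z | z ∈ torusPoints W ∧ IsSpecialPoint z} ⊆ unitCircle :=
      fun z hz ↦ IsSpecialPoint.norm_eq_one hz.2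
    have hcircle : ∀ z : ℂ, MvPolynomial.aeval (realCoords z)
        (MvPolynomial.X 0 ^ 2 + MvPolynomial.X 1 ^ 2 - 1 : PlaneRing) = 0 ↔ ‖z‖ = 1 := by
      intro z
      rw [← sq_eq_sq₀ (norm_nonneg z) zero_le_one, Complex.sq_norm, Complex.normSq_apply]
      simp only [realCoords, map_sub, map_add, map_pow, map_one, MvPolynomial.aeval_X,
        Matrix.cons_val_zero, Matrix.cons_val_one, sub_eq_zero, one_pow]
      rw [sq, sq]
    refine Set.Subset.antisymm (fun z hz ↦ ?_) fun z hz ↦ (hWP z).2 fun f hf ↦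
      aeval_eq_zero_of_infinite_zeros_unitCircle h hU1 (fun z hz ↦ (hWP z).1 hz.1 f hf) z hz
    -- Otherwise the curve of `P` would meet the unit circle in finitely many points, yet every
    -- special point of `W` lies on both.
    have hmem : (MvPolynomial.X 0 ^ 2 + MvPolynomial.X 1 ^ 2 - 1 : PlaneRing) ∈ P := by
      by_contra hnot
      refine h.image (f := fun z : ℂˣ ↦ realCoords z)
        (realCoords_injective.comp Units.val_injective).injOn
        ((finite_zeros_of_notMem hP0 hnot).subset ?_)
      rintro _ ⟨z, hz, rfl⟩
      exact ⟨fun g hg ↦ (hWP z).1 hz.1 g hg, (hcircle z).2 (hU1 hz)⟩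
    exact (hcircle z).1 ((hWP z).1 hz _ hmem)
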